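/- Let $K$ be a field of characteristic zero, let $r\ge n\ge 2$ and $0\le m<r-n+1$ be integers, and let $S=K[x_1,\dots,x_n]$. Let $\mathcal A$ be a generic central arrangement of $r$ distinct hyperplanes in $K^n$, that is, a set of $r$ linear hyperplanes any $n$ of which intersect only at the origin. For each $H\in\mathcal A$ fix a linear form $p_H\in S$ defining $H$, and put $Q=\prod_{H\in\mathcal A}p_H$. Let $D(S)=S\langle\partial_1,\dots,\partial_n\rangle$ be the $n$th Weyl algebra, acting on $S$ by $(\theta,g)\mapsto\theta*g$. Let $D^{(m)}(\mathcal A)$ be the $S$-module of all operators $\theta=\sum_{|\alpha|=m}f_\alpha\partial^\alpha\in D(S)$ with $\theta*(QS)\subseteq QS$. A nonzero operator $\sum_\alpha f_\alpha\partial^\alpha$ is homogeneous of polynomial degree $d$ if every nonzero $f_\alpha$ is a homogeneous polynomial of degree $d$. Fix $m$ distinct hyperplanes $H_1,\dots,H_m\in\mathcal A$ and put $$\Xi^{(m)}(\mathcal A)=\{\theta\in D^{(m)}(\mathcal A)\;:\;\theta*(p_{H_1}\cdots p_{H_m})=0\}.$$ 1. The $S$-module $\Xi^{(m)}(\mathcal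 A)$ is minimally generated by $\binom{r}{n-1}-\binom{r-m}{n-1}$ operators, all homogeneous of polynomial degree $r-n+1$: there is a system of generators consisting of this many such operators, none of them is redundant, and no system of generators of $\Xi^{(m)}(\mathcal A)$ has fewer elements. 2. If moreover $n\ge 3$ and $m\ge 1$, then $$\binom{r}{n-1}-\binom{r-m}{n-1}+1>\binom{n+m-1}{n-1},$$ and the $S$-module $D^{(m)}(\mathcal A)$ is not free. -/

import Mathlib

namespace GenericArrangement

/-- The endomorphism `∂^α = ∂₁^{α₁} ⋯ ∂ₙ^{αₙ}` of the polynomial ring `S = K[x₁, …, xₙ]`. -/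
noncomputable def partialPow {K : Type*} [Field K] {n : ℕ} (α : Fin n →₀ ℕ) :
    Module.End K (MvPolynomial (Fin n) K) :=
  (List.ofFn fun i : Fin n =>
    ((MvPolynomial.pderiv i : Derivation K (MvPolynomial (Fin n) K) (MvPolynomial (Fin n) K)) :
      Module.End K (MvPolynomial (Fin n) K)) ^ α i).prod

/-- The `n`-th Weyl algebra `D(S) = S⟨∂₁, …, ∂ₙ⟩`, realised (the ground field has characteristic
zero wherever it is used) as the algebra of `K`-linear operators on `S` generated by the
multiplications by elements of `S` and by the partial derivatives. -/
noncomputable def weylAlgebra (K : Type*) [Field K] (n : ℕ) :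
    Subalgebra K (Module.End K (MvPolynomial (Fin n) K)) :=
  Algebra.adjoin K
    (Set.range (fun f : MvPolynomial (Fin n) K => LinearMap.mulLeft K f) ∪
      Set.range (fun i : Fin n =>
        ((MvPolynomial.pderiv i :
          Derivation K (MvPolynomial (Fin n) K) (MvPolynomial (Fin n) K)) :
            Module.End K (MvPolynomial (Fin n) K))))

theorem smul_mem_weylAlgebra {K : Type*} [Field K] {n : ℕ} (f : MvPolynomial (Fin n) K)
    {θ : Module.End K (MvPolynomial (Fin n) K)} (hθ : θ ∈ weylAlgebra K n) :
    f • θ ∈ weylAlgebra K n := by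
  have h : f • θ = LinearMap.mulLeft K f * θ := by
    ext1 x
    rfl
  rw [h]
  exact mul_mem (Algebra.subset_adjoin (Or.inl ⟨f, rfl⟩)) hθ

/-- The idealizer `D(I) = {θ ∈ D(S) | θ * I ⊆ I}` of an ideal `I`, as an `S`-module
(with `(f • θ) * g = f (θ * g)`). -/
noncomputable def idealizer {K : Type*} [Field K] {n : ℕ}
    (I : Ideal (MvPolynomial (Fin n) K)) :
    Submodule (MvPolynomial (Fin n) K) (Module.End K (MvPolynomial (Fin n) K)) where
  carrier := {θ | θ ∈ weylAlgebra K n ∧ ∀ g ∈ I, θ g ∈ I}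
  add_mem' := fun ha hb => ⟨add_mem ha.1 hb.1, fun g hg => I.add_mem (ha.2 g hg) (hb.2 g hg)⟩
  zero_mem' := ⟨zero_mem _, fun _ _ => I.zero_mem⟩
  smul_mem' := fun f _ hθ =>
    ⟨smul_mem_weylAlgebra f hθ.1, fun g hg => I.mul_mem_left f (hθ.2 g hg)⟩

/-- `D^{(m)}(S)`: the operators `∑_{|α| = m} f_α ∂^α`, homogeneous of order `m`. -/
noncomputable def homogeneousOperators (K : Type*) [Field K] (n m : ℕ) :
    Submodule (MvPolynomial (Fin n) K) (Module.End K (MvPolynomial (Fin n) K)) :=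
  Submodule.span (MvPolynomial (Fin n) K)
    {θ | ∃ α : Fin n →₀ ℕ, α.degree = m ∧ θ = partialPow α}

/-- The operators homogeneous of order `m` do belong to the Weyl algebra. -/
theorem homogeneousOperators_subset_weylAlgebra (K : Type*) [Field K] (n m : ℕ) :
    ∀ θ ∈ homogeneousOperators K n m, θ ∈ weylAlgebra K n := by
  intro θ hθ
  induction hθ using Submodule.span_induction with
  | mem x hx =>
    obtain ⟨α, -, rfl⟩ := hx
    refine list_prod_mem ?_
    intro y hy
    rw [List.mem_ofFn] at hy
    obtain ⟨i, rfl⟩ := hy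
    refine Subalgebra.pow_mem (weylAlgebra K n) ?_ _
    apply Algebra.subset_adjoin
    exact Or.inr ⟨i, rfl⟩
  | zero => exact zero_mem _
  | add x y _ _ hx hy => exact add_mem hx hy
  | smul f x _ hx => exact smul_mem_weylAlgebra f hx

/-- A (nonzero) operator is homogeneous of polynomial degree `d` if it can be written
as `∑_α f_α ∂^α` with every coefficient `f_α` zero or homogeneous of degree `d`. -/
def HasPolynomialDegree {K : Type*} [Field K] {n : ℕ} (d : ℕ)
    (θ : Module.End K (MvPolynomial (Fin n) K)) : Prop :=
  θ ≠ 0 ∧ ∃ f : (Fin n →₀ ℕ) →₀ MvPolynomial (Fin n) K,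
    θ = (f.sum fun α g => g • partialPow α) ∧ ∀ α, (f α).IsHomogeneous d

/-- A finite set of hyperplanes of `K^n` through the origin is a generic central arrangement if
any `n` of them intersect only at the origin. -/
structure IsGeneric {K : Type*} [Field K] {n : ℕ}
    (A : Finset (Submodule K (Fin n → K))) : Prop where
  hyperplane : ∀ H ∈ A, IsCoatom H
  generic : ∀ T ⊆ A, T.card = n → T.inf id = ⊥

/-- `ℓ ∈ S` is a linear form defining the hyperplane `H`. -/
def IsDefiningForm {K : Type*} [Field K] {n : ℕ} (ℓ : MvPolynomial (Fin n) K)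
    (H : Submodule K (Fin n → K)) : Prop :=
  ℓ.IsHomogeneous 1 ∧ ∀ v : Fin n → K, v ∈ H ↔ MvPolynomial.eval v ℓ = 0

/-- `D^{(m)}(𝒜)`: the operators homogeneous of order `m` in `D(𝒜) = D(⟨Q⟩)`, where
`Q = ∏_{H ∈ 𝒜} p_H`. -/
noncomputable def arrangementOperators {K : Type*} [Field K] {n : ℕ}
    (A : Finset (Submodule K (Fin n → K)))
    (p : Submodule K (Fin n → K) → MvPolynomial (Fin n) K) (m : ℕ) :
    Submodule (MvPolynomial (Fin n) K) (Module.End K (MvPolynomial (Fin n) K)) :=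
  idealizer (Ideal.span {∏ H ∈ A, p H}) ⊓ homogeneousOperators K n m

/-- `Ξ^{(m)}(𝒜) = {θ ∈ D^{(m)}(𝒜) | θ * ∏_{H ∈ B} p_H = 0}`, for the `m` hyperplanes `B ⊆ 𝒜`. -/
noncomputable def annihilatingOperators {K : Type*} [Field K] {n : ℕ}
    (A : Finset (Submodule K (Fin n → K)))
    (p : Submodule K (Fin n → K) → MvPolynomial (Fin n) K) (m : ℕ)
    (B : Finset (Submodule K (Fin n → K))) :
    Submodule (MvPolynomial (Fin n) K) (Module.End K (MvPolynomial (Fin n) K)) where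
  carrier := {θ | θ ∈ arrangementOperators A p m ∧ θ (∏ H ∈ B, p H) = 0}
  add_mem' := fun ha hb => ⟨add_mem ha.1 hb.1, by
    rw [LinearMap.add_apply, ha.2, hb.2, add_zero]⟩
  zero_mem' := ⟨zero_mem _, rfl⟩
  smul_mem' := fun f _ hθ => ⟨Submodule.smul_mem _ f hθ.1, by
    rw [LinearMap.smul_apply, hθ.2, smul_zero]⟩

/-- The family `θ` of `N` elements is a minimal system of generators of `M`: it generates `M`,
no member is redundant, and no system of generators of `M` has fewer than `N` elements. -/
structure IsMinimalGenerators {R V : Type*} [Semiring R] [AddCommMonoid V] [Module R V]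
    {N : ℕ} (θ : Fin N → V) (M : Submodule R V) : Prop where
  span_eq : Submodule.span R (Set.range θ) = M
  irredundant : ∀ i, θ i ∉ Submodule.span R (θ '' {j | j ≠ i})
  card_le : ∀ T : Finset V, Submodule.span R (T : Set V) = M → N ≤ T.card

end GenericArrangement

/-! In characteristic zero an operator homogeneous of order `m` is the same thing as a linear map
from the forms of degree `m` to `S` (`operatorOf_apply`, `operator_ext`). For such an operator,
preserving `QS` amounts to sending each product `p_J` of `m` of the forms to a multiple of itself
(`mem_idealizer_iff`). The problem thus becomes linear algebra on forms of degree `m`.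

Any `n - 1` hyperplanes of the arrangement meet in a line; let `v_X` span the line of the subset
`X`. The obvious solutions are the identity, which gives the Euler operator, and the line operators
`g ↦ g(v_X) ∏_{i ∉ X} p_i`. They generate all solutions (`exists_mem_lineSpan`). For exactly `n - 1
+ m` hyperplanes this is Lagrange interpolation at the lines; in general one restricts to a
hyperplane and inducts on the dimension and on the number of hyperplanes.

Let `B` be the chosen `m` hyperplanes. Interpolation on `X ∪ B` eliminates the line operators whose
`X` misses `B` (`exists_sum_meeting`). The remaining ones kill `p_B`, whereas the Euler operator
fixes it, so they generate `Ξ`; their number is the difference of binomials. Restricting a relation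
to the line of `Y` leaves only the term of `Y`, so every coefficient of a relation has zero constant
term (`constantCoeff_eq_zero_of_relation`). This gives minimality.

Adding the Euler operator gives a minimal generating system of `D^{(m)}(𝒜)`. Its size exceeds the
bound `(n+m-1).choose (n-1)` on the rank, so the module is not free. -/

namespace GenericArrangement

open MvPolynomial

set_option linter.unusedSectionVars false

/-! ### Restriction of polynomials to a hyperplane. -/

section Restriction

variable {K : Type*} [Field K]

theorem exists_eq_sum_C_mul_X {n : ℕ} {l : MvPolynomial (Fin n) K} (hl : l.IsHomogeneous 1) :
    ∃ a : Fin n → K, l = ∑ i, C (a i) * X i := by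
  have h : l ∈ homogeneousSubmodule (Fin n) K 1 := hl
  rw [homogeneousSubmodule_one_eq_span_X, Submodule.mem_span_range_iff_exists_fun] at h
  obtain ⟨a, rfl⟩ := h
  exact ⟨a, by simp [smul_eq_C_mul]⟩

theorem isHomogeneous_of_mul_left {n m d : ℕ} {l h : MvPolynomial (Fin n) K}
    (hl : l.IsHomogeneous d) (hl0 : l ≠ 0) (hlh : (l * h).IsHomogeneous (d + m)) :
    h.IsHomogeneous m := by
  let _ := MvPolynomial.gradedAlgebra (σ := Fin n) (R := K)
  have h1 := DirectSum.coe_decompose_mul_add_of_left_mem (homogeneousSubmodule (Fin n) K)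
    (i := d) (j := m) (b := h) hl
  rw [DirectSum.decompose_of_mem_same (homogeneousSubmodule (Fin n) K) hlh] at h1
  rw [mul_left_cancel₀ hl0 h1]
  exact (DirectSum.decompose (homogeneousSubmodule (Fin n) K) h m).2

/-- Restriction of polynomials to the hyperplane `l = 0` of `K^(n+1)`, identified with `K^n` by a
projection `proj` along a coordinate axis, with inverse `incl`. -/
structure HyperplaneRestriction {n : ℕ} (l : MvPolynomial (Fin (n + 1)) K) where
  res : MvPolynomial (Fin (n + 1)) K →ₐ[K] MvPolynomial (Fin n) K
  lift : MvPolynomial (Fin n) K →ₐ[K] MvPolynomial (Fin (n + 1)) K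
  incl : (Fin n → K) → (Fin (n + 1) → K)
  proj : (Fin (n + 1) → K) → (Fin n → K)
  res_lift : ∀ g, res (lift g) = g
  res_eq_zero_iff : ∀ g, res g = 0 ↔ l ∣ g
  isHomogeneous_res : ∀ {d g}, IsHomogeneous g d → (res g).IsHomogeneous d
  isHomogeneous_lift : ∀ {d g}, IsHomogeneous g d → (lift g).IsHomogeneous d
  eval_res : ∀ w g, eval w (res g) = eval (incl w) g
  incl_proj : ∀ v, eval v l = 0 → incl (proj v) = v
  incl_eq_zero_iff : ∀ w, incl w = 0 ↔ w = 0

/-- The equation `l = 0` is solved for a variable whose coefficient is nonzero; the remaining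
variables are coordinates on the hyperplane. -/
theorem nonempty_hyperplaneRestriction {n : ℕ} {l : MvPolynomial (Fin (n + 1)) K}
    (hl : l.IsHomogeneous 1) (hl0 : l ≠ 0) : Nonempty (HyperplaneRestriction l) := by
  obtain ⟨a, ha⟩ := exists_eq_sum_C_mul_X hl
  obtain ⟨k, hk⟩ : ∃ k, a k ≠ 0 := by
    by_contra! h
    exact hl0 (by simp [ha, h])
  rw [Fin.sum_univ_succAbove _ k] at ha
  set c : Fin n → K := fun j => -(a (k.succAbove j) / a k) with hc
  set y : MvPolynomial (Fin n) K := ∑ j, C (c j) * X j with hy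
  set ρ : MvPolynomial (Fin (n + 1)) K →ₐ[K] MvPolynomial (Fin n) K :=
    aeval (k.insertNth y X) with hρ
  set s : MvPolynomial (Fin n) K →ₐ[K] MvPolynomial (Fin (n + 1)) K :=
    rename k.succAbove with hs
  have hρk : ρ (X k) = y := by simp [hρ]
  have hρj : ∀ j, ρ (X (k.succAbove j)) = X j := by simp [hρ]
  have hρs : ∀ g, ρ (s g) = g := by
    intro g
    have : ρ.comp s = AlgHom.id K _ := by
      ext j
      simp [hs, hρj]
    exact DFunLike.congr_fun this g
  have hac : ∀ j, a (k.succAbove j) + a k * c j = 0 := by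
    intro j; simp only [hc]; field_simp; ring
  have hρl : ρ l = 0 := by
    rw [ha]
    simp only [map_add, map_mul, map_sum, hρk, hρj, algHom_C, algebraMap_eq, hy, Finset.mul_sum,
      ← Finset.sum_add_distrib]
    refine Finset.sum_eq_zero fun j _ => ?_
    rw [← mul_assoc, ← C_mul, ← add_mul, ← C_add, add_comm, hac, C_0, zero_mul]
  -- Modulo `l`, the identity and `s ∘ ρ` are algebra maps that agree on the variables, hence
  -- everywhere.
  have hsub : ∀ g, l ∣ g - s (ρ g) := by
    intro g
    rw [← Ideal.mem_span_singleton, ← Ideal.Quotient.eq]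
    have : (Ideal.Quotient.mkₐ K (Ideal.span {l})) =
        (Ideal.Quotient.mkₐ K (Ideal.span {l})).comp (s.comp ρ) := by
      refine MvPolynomial.algHom_ext fun j => ?_
      refine Fin.succAboveCases k ?_ (fun j => ?_) j
      · simp only [AlgHom.comp_apply, hρk, Ideal.Quotient.mkₐ_eq_mk]
        rw [Ideal.Quotient.eq, Ideal.mem_span_singleton]
        refine ⟨C (a k)⁻¹, ?_⟩
        rw [ha, add_mul, Finset.sum_mul, mul_right_comm, ← C_mul, mul_inv_cancel₀ hk, C_1, one_mul,
          sub_eq_add_neg, hy, map_sum, ← Finset.sum_neg_distrib]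
        congr 1
        refine Finset.sum_congr rfl fun j _ => ?_
        rw [map_mul, algHom_C, hs, rename_X, mul_right_comm, ← C_mul, ← neg_mul, algebraMap_eq,
          ← C_neg, hc]
        simp [div_eq_mul_inv]
      · simp only [AlgHom.comp_apply, hρj, hs, rename_X]
    exact DFunLike.congr_fun this g
  refine ⟨⟨ρ, s, fun w => k.insertNth (∑ j, c j * w j) w, fun v j => v (k.succAbove j), hρs,
    fun g => ⟨fun h => ?_, ?_⟩, fun {d g} hg => ?_, fun hg => hg.rename_isHomogeneous,
    fun w g => ?_, fun v hv => ?_, fun w => ⟨fun h => ?_, ?_⟩⟩⟩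
  · simpa [h] using hsub g
  · rintro ⟨h, rfl⟩
    rw [map_mul, hρl, zero_mul]
  · have := hg.aeval (k.insertNth y X : Fin (n + 1) → MvPolynomial (Fin n) K) (n := 1) ?_
    · rwa [one_mul] at this
    · intro j
      refine Fin.succAboveCases k ?_ (fun j => ?_) j
      · rw [Fin.insertNth_apply_same]
        exact IsHomogeneous.sum _ _ _ fun j _ => isHomogeneous_C_mul_X _ _
      · rw [Fin.insertNth_apply_succAbove]
        exact isHomogeneous_X _ _
  · have : (aeval w).comp ρ =
        aeval (R := K) (k.insertNth (∑ j, c j * w j) w : Fin (n + 1) → K) := by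
      refine MvPolynomial.algHom_ext fun j => ?_
      refine Fin.succAboveCases k ?_ (fun j => ?_) j
      · simp [hρk, hy]
      · simp [hρj]
    simpa [aeval_eq_eval] using DFunLike.congr_fun this g
  · funext j
    refine Fin.succAboveCases k ?_ (fun j => ?_) j
    · rw [Fin.insertNth_apply_same]
      apply mul_left_cancel₀ hk
      rw [ha] at hv
      simp only [map_add, map_mul, map_sum, eval_C, eval_X] at hv
      rw [← sub_eq_zero, Finset.mul_sum, ← neg_eq_zero, ← hv, neg_sub, sub_eq_add_neg,
        ← Finset.sum_neg_distrib]
      congr 1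
      refine Finset.sum_congr rfl fun j _ => ?_
      linear_combination (-v (k.succAbove j)) * hac j
    · rw [Fin.insertNth_apply_succAbove]
  · funext j
    have := congrFun h (k.succAbove j)
    rwa [Fin.insertNth_apply_succAbove] at this
  · rintro rfl
    funext j
    refine Fin.succAboveCases k ?_ (fun j => ?_) j <;> simp

end Restriction

/-! ### Generic families of linear forms and Lagrange interpolation at their lines. -/

section GenericFamily

variable {K : Type*} [Field K] {ι : Type*} [DecidableEq ι]

/-- A family of linear forms on `K^(n+1)` any `n + 1` of which have only the trivial common zero,
together with a spanning vector `v X` of the common zero line of every `n` of them. -/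
structure IsGenericFamily {n : ℕ} (A : Finset ι) (p : ι → MvPolynomial (Fin (n + 1)) K)
    (v : Finset ι → Fin (n + 1) → K) : Prop where
  isHomogeneous : ∀ i ∈ A, (p i).IsHomogeneous 1
  eq_zero : ∀ T ⊆ A, T.card = n + 1 → ∀ w, (∀ i ∈ T, eval w (p i) = 0) → w = 0
  line_ne_zero : ∀ X ⊆ A, X.card = n → v X ≠ 0
  eval_line : ∀ X ⊆ A, X.card = n → ∀ i ∈ X, eval (v X) (p i) = 0

/-- The product of the forms outside `X`. -/
noncomputable def coProd {n : ℕ} (A : Finset ι) (p : ι → MvPolynomial (Fin n) K)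
    (X : Finset ι) : MvPolynomial (Fin n) K :=
  ∏ i ∈ A \ X, p i

namespace IsGenericFamily

variable {n : ℕ} {A : Finset ι} {p : ι → MvPolynomial (Fin (n + 1)) K}
  {v : Finset ι → Fin (n + 1) → K}

theorem mono (h : IsGenericFamily A p v) {A' : Finset ι} (hA : A' ⊆ A) :
    IsGenericFamily A' p v :=
  ⟨fun i hi => h.isHomogeneous i (hA hi), fun T hT => h.eq_zero T (hT.trans hA),
    fun X hX => h.line_ne_zero X (hX.trans hA), fun X hX => h.eval_line X (hX.trans hA)⟩

theorem eval_ne_zero (h : IsGenericFamily A p v) {X : Finset ι} (hX : X ⊆ A) (hXc : X.card = n)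
    {i : ι} (hi : i ∈ A) (hiX : i ∉ X) : eval (v X) (p i) ≠ 0 := by
  intro h0
  refine h.line_ne_zero X hX hXc (h.eq_zero (insert i X) (Finset.insert_subset hi hX)
    (by rw [Finset.card_insert_of_notMem hiX, hXc]) _ fun j hj => ?_)
  obtain rfl | hj := Finset.mem_insert.1 hj
  · exact h0
  · exact h.eval_line X hX hXc j hj

theorem ne_zero (h : IsGenericFamily A p v) (hA : n + 1 ≤ A.card) {i : ι} (hi : i ∈ A) :
    p i ≠ 0 := by
  obtain ⟨X, hX, hXc⟩ := Finset.exists_subset_card_eq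
    (show n ≤ (A.erase i).card by rw [Finset.card_erase_of_mem hi]; omega)
  intro h0
  exact h.eval_ne_zero (hX.trans (Finset.erase_subset _ _)) hXc hi
    (fun hh => Finset.notMem_erase i A (hX hh)) (by rw [h0, map_zero])

theorem isHomogeneous_prod (h : IsGenericFamily A p v) {J : Finset ι} (hJ : J ⊆ A) :
    (∏ i ∈ J, p i).IsHomogeneous J.card := by
  simpa using IsHomogeneous.prod J p (fun _ => 1) fun i hi => h.isHomogeneous i (hJ hi)

theorem prod_ne_zero (h : IsGenericFamily A p v) (hA : n + 1 ≤ A.card) {J : Finset ι}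
    (hJ : J ⊆ A) : ∏ i ∈ J, p i ≠ 0 :=
  Finset.prod_ne_zero_iff.2 fun _ hi => h.ne_zero hA (hJ hi)

theorem eval_coProd_ne_zero (h : IsGenericFamily A p v) {X : Finset ι} (hX : X ⊆ A)
    (hXc : X.card = n) : eval (v X) (coProd A p X) ≠ 0 := by
  rw [coProd, map_prod, Finset.prod_ne_zero_iff]
  intro i hi
  rw [Finset.mem_sdiff] at hi
  exact h.eval_ne_zero hX hXc hi.1 hi.2

theorem eval_prod_eq_zero (h : IsGenericFamily A p v) {X J : Finset ι} (hX : X ⊆ A)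
    (hXc : X.card = n) (hJ : ¬ Disjoint X J) : eval (v X) (∏ i ∈ J, p i) = 0 := by
  obtain ⟨i, hiX, hiJ⟩ := Finset.not_disjoint_iff.1 hJ
  rw [map_prod]
  exact Finset.prod_eq_zero hiJ (h.eval_line X hX hXc i hiX)

theorem eval_coProd_eq_zero (h : IsGenericFamily A p v) {X Y : Finset ι} (hY : Y ⊆ A)
    (hXc : X.card = n) (hYc : Y.card = n) (hne : Y ≠ X) : eval (v Y) (coProd A p X) = 0 := by
  refine h.eval_prod_eq_zero hY hYc fun hd => hne ?_
  refine Finset.eq_of_subset_of_card_le (fun i hi => ?_) (by omega)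
  by_contra hiX
  exact Finset.disjoint_left.1 hd hi (Finset.mem_sdiff.2 ⟨hY hi, hiX⟩)

theorem isHomogeneous_coProd (h : IsGenericFamily A p v) {X : Finset ι} (hX : X ⊆ A) {m : ℕ}
    (hm : A.card = X.card + m) : (coProd A p X).IsHomogeneous m := by
  have := h.isHomogeneous_prod (J := A \ X) Finset.sdiff_subset
  rwa [Finset.card_sdiff_of_subset hX, hm, Nat.add_sub_cancel_left] at this

/-- The lines of the restricted arrangement are those lines of the original one that lie in the
hyperplane of `i`, so `X` corresponds to `insert i X`. -/
theorem restrict {p : ι → MvPolynomial (Fin (n + 1 + 1)) K} {v : Finset ι → Fin (n + 1 + 1) → K}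
    (h : IsGenericFamily A p v) {i : ι} (hi : i ∈ A) (ρ : HyperplaneRestriction (p i)) :
    IsGenericFamily (A.erase i) (fun j => ρ.res (p j)) (fun X => ρ.proj (v (insert i X))) := by
  have hins : ∀ X ⊆ A.erase i, insert i X ⊆ A ∧ (insert i X).card = X.card + 1 := by
    intro X hX
    refine ⟨Finset.insert_subset hi (hX.trans (Finset.erase_subset _ _)), ?_⟩
    exact Finset.card_insert_of_notMem fun hh => Finset.notMem_erase i A (hX hh)
  have hv : ∀ X ⊆ A.erase i, X.card = n →
      ρ.incl (ρ.proj (v (insert i X))) = v (insert i X) := by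
    intro X hX hXc
    obtain ⟨h1, h2⟩ := hins X hX
    exact ρ.incl_proj _ (h.eval_line _ h1 (by omega) i (Finset.mem_insert_self _ _))
  refine ⟨fun j hj => ρ.isHomogeneous_res (h.isHomogeneous j (Finset.mem_of_mem_erase hj)),
    fun T hT hTc w hw => ?_, fun X hX hXc h0 => ?_, fun X hX hXc j hj => ?_⟩
  · obtain ⟨h1, h2⟩ := hins T hT
    rw [← ρ.incl_eq_zero_iff]
    refine h.eq_zero _ h1 (by omega) _ fun j hj => ?_
    rw [← ρ.eval_res]
    obtain rfl | hj := Finset.mem_insert.1 hj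
    · rw [(ρ.res_eq_zero_iff _).2 dvd_rfl, map_zero]
    · exact hw j hj
  · obtain ⟨h1, h2⟩ := hins X hX
    refine h.line_ne_zero _ h1 (by omega) ?_
    rw [← hv X hX hXc, h0, ρ.incl_eq_zero_iff]
  · obtain ⟨h1, h2⟩ := hins X hX
    rw [ρ.eval_res, hv X hX hXc]
    exact h.eval_line _ h1 (by omega) j (Finset.mem_insert_of_mem hj)

theorem eval_restrict {p : ι → MvPolynomial (Fin (n + 1 + 1)) K}
    {v : Finset ι → Fin (n + 1 + 1) → K}
    (h : IsGenericFamily A p v) {i : ι} (hi : i ∈ A) (ρ : HyperplaneRestriction (p i))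
    {X : Finset ι} (hX : X ⊆ A.erase i) (hXc : X.card = n) (g : MvPolynomial (Fin (n + 1 + 1)) K) :
    eval (ρ.proj (v (insert i X))) (ρ.res g) = eval (v (insert i X)) g := by
  rw [ρ.eval_res, ρ.incl_proj]
  refine h.eval_line _ (Finset.insert_subset hi (hX.trans (Finset.erase_subset _ _))) ?_ i
    (Finset.mem_insert_self _ _)
  rw [Finset.card_insert_of_notMem fun hh => Finset.notMem_erase i A (hX hh), hXc]

end IsGenericFamily

theorem eq_C_mul_X_pow {m : ℕ} {g : MvPolynomial (Fin 1) K} (hg : g.IsHomogeneous m) :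
    ∃ c : K, g = C c * X 0 ^ m := by
  refine ⟨coeff (Finsupp.single 0 m) g, ?_⟩
  rw [C_mul_X_pow_eq_monomial]
  ext d
  rw [coeff_monomial]
  split_ifs with hd
  · rw [hd]
  · refine hg.coeff_eq_zero fun hdm => hd ?_
    refine Finsupp.ext fun j => ?_
    rw [Fin.fin_one_eq_zero j, ← hdm, Finsupp.degree_eq_sum]
    simp

theorem exists_eq_mul_of_dvd {n m : ℕ} {l g : MvPolynomial (Fin n) K} (hl : l.IsHomogeneous 1)
    (hl0 : l ≠ 0) (hg : g.IsHomogeneous (m + 1)) (h : l ∣ g) :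
    ∃ q, q.IsHomogeneous m ∧ g = l * q := by
  obtain ⟨q, rfl⟩ := h
  exact ⟨q, isHomogeneous_of_mul_left hl hl0 (by rwa [add_comm]), rfl⟩

/-- Double induction on dimension and degree. On the hyperplane of `i`, `g` vanishes by the case of
smaller dimension, so `g = p i * q`; then `q` vanishes on the lines outside that hyperplane, which
are the lines of `A.erase i`. -/
theorem IsGenericFamily.eq_zero_of_eval_lines {n : ℕ} : ∀ {m : ℕ} {A : Finset ι}
    {p : ι → MvPolynomial (Fin (n + 1)) K} {v : Finset ι → Fin (n + 1) → K}
    (_ : IsGenericFamily A p v) (_ : A.card = n + m)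
    {g : MvPolynomial (Fin (n + 1)) K} (_ : g.IsHomogeneous m)
    (_ : ∀ X ⊆ A, X.card = n → eval (v X) g = 0), g = 0 := by
  induction n with
  | zero =>
    intro m A p v h hA g hg hv
    obtain ⟨c, rfl⟩ := eq_C_mul_X_pow hg
    have h1 := hv ∅ (Finset.empty_subset _) rfl
    have h2 : v ∅ 0 ≠ 0 := fun h0 =>
      h.line_ne_zero ∅ (Finset.empty_subset _) rfl
        (funext fun j => by obtain rfl := Fin.fin_one_eq_zero j; exact h0)
    rw [map_mul, eval_C, map_pow, eval_X, mul_eq_zero] at h1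
    rw [h1.resolve_right (pow_ne_zero m h2), C_0, zero_mul]
  | succ n ih =>
    intro m
    induction m with
    | zero =>
      intro A p v h hA g hg hv
      have h1 := hv A subset_rfl hA
      have h2 : g ∈ homogeneousSubmodule (Fin (n + 1 + 1)) K 0 := hg
      rw [homogeneousSubmodule_zero, Submodule.mem_one] at h2
      obtain ⟨c, rfl⟩ := h2
      simp only [algebraMap_eq, eval_C] at h1
      rw [h1, map_zero]
    | succ m ihm =>
      intro A p v h hA g hg hv
      obtain ⟨i, hi⟩ : A.Nonempty := Finset.card_pos.1 (by omega)
      have hpi := h.ne_zero (by omega) hi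
      have hA' : (A.erase i).card + 1 = A.card := Finset.card_erase_add_one hi
      obtain ⟨ρ⟩ := nonempty_hyperplaneRestriction (h.isHomogeneous i hi) hpi
      have hρ : ρ.res g = 0 := by
        refine ih (h.restrict hi ρ) (by omega) (ρ.isHomogeneous_res hg) fun X hX hXc => ?_
        rw [h.eval_restrict hi ρ hX hXc]
        refine hv _ (Finset.insert_subset hi (hX.trans (Finset.erase_subset _ _))) ?_
        rw [Finset.card_insert_of_notMem fun hh => Finset.notMem_erase i A (hX hh), hXc]
      obtain ⟨q, hq, rfl⟩ := exists_eq_mul_of_dvd (h.isHomogeneous i hi) hpi hg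
        ((ρ.res_eq_zero_iff g).1 hρ)
      rw [ihm (h.mono (Finset.erase_subset i A)) (by omega) hq fun X hX hXc => ?_, mul_zero]
      have hXA := hX.trans (Finset.erase_subset i A)
      have := hv X hXA hXc
      rw [map_mul, mul_eq_zero] at this
      exact this.resolve_left (h.eval_ne_zero hXA hXc hi
        fun hh => Finset.notMem_erase i A (hX hh))

/-- The product `coProd A p X` vanishes at every `v Y` with `Y ≠ X` but not at `v X`, so these
products play the role of Lagrange polynomials. -/
theorem IsGenericFamily.interpolation {n m : ℕ} {A : Finset ι}
    {p : ι → MvPolynomial (Fin (n + 1)) K} {v : Finset ι → Fin (n + 1) → K}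
    (h : IsGenericFamily A p v) (hA : A.card = n + m)
    {g : MvPolynomial (Fin (n + 1)) K} (hg : g.IsHomogeneous m) :
    g = ∑ X ∈ A.powersetCard n, (eval (v X) g / eval (v X) (coProd A p X)) • coProd A p X := by
  rw [← sub_eq_zero]
  refine h.eq_zero_of_eval_lines hA (hg.sub (IsHomogeneous.sum _ _ _ fun X hX => ?_))
    fun Y hY hYc => ?_
  · rw [Finset.mem_powersetCard] at hX
    rw [smul_eq_C_mul]
    exact (h.isHomogeneous_coProd hX.1 (by omega)).C_mul _
  · rw [map_sub, map_sum, Finset.sum_eq_single Y, smul_eval,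
      div_mul_cancel₀ _ (h.eval_coProd_ne_zero hY hYc), sub_self]
    · intro X hX hne
      rw [Finset.mem_powersetCard] at hX
      rw [smul_eval, h.eval_coProd_eq_zero hY hX.2 hYc hne.symm, mul_zero]
    · intro hY'
      exact absurd (Finset.mem_powersetCard.2 ⟨hY, hYc⟩) hY'

end GenericFamily

/-! ### The identity and the line operators generate all solutions. -/

section Generation

variable {K : Type*} [Field K] {ι : Type*} [DecidableEq ι]

/-- The operator `g ↦ g(v_X) ∏_{i ∉ X} p_i`. -/
noncomputable def lineOperator {n : ℕ} (A : Finset ι) (p : ι → MvPolynomial (Fin n) K)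
    (v : Finset ι → Fin n → K) (X : Finset ι) : Module.End K (MvPolynomial (Fin n) K) :=
  (aeval (v X)).toLinearMap.smulRight (coProd A p X)

theorem lineOperator_apply {n : ℕ} (A : Finset ι) (p : ι → MvPolynomial (Fin n) K)
    (v : Finset ι → Fin n → K) (X : Finset ι) (g : MvPolynomial (Fin n) K) :
    lineOperator A p v X g = eval (v X) g • coProd A p X := by
  simp [lineOperator, aeval_eq_eval]

/-- The span of the identity and of the line operators. -/
noncomputable def lineSpan {n : ℕ} (A : Finset ι) (p : ι → MvPolynomial (Fin (n + 1)) K)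
    (v : Finset ι → Fin (n + 1) → K) :
    Submodule (MvPolynomial (Fin (n + 1)) K) (Module.End K (MvPolynomial (Fin (n + 1)) K)) :=
  Submodule.span _ ({1} ∪ lineOperator A p v '' {X | X ⊆ A ∧ X.card = n})

theorem one_mem_lineSpan {n : ℕ} (A : Finset ι) (p : ι → MvPolynomial (Fin (n + 1)) K)
    (v : Finset ι → Fin (n + 1) → K) : 1 ∈ lineSpan A p v :=
  Submodule.subset_span (Or.inl rfl)

theorem lineOperator_mem_lineSpan {n : ℕ} {A : Finset ι} (p : ι → MvPolynomial (Fin (n + 1)) K)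
    (v : Finset ι → Fin (n + 1) → K) {X : Finset ι} (hX : X ⊆ A) (hXc : X.card = n) :
    lineOperator A p v X ∈ lineSpan A p v :=
  Submodule.subset_span (Or.inr ⟨X, ⟨hX, hXc⟩, rfl⟩)

theorem End_smul_apply {n : ℕ} (f : MvPolynomial (Fin n) K)
    (θ : Module.End K (MvPolynomial (Fin n) K)) (g : MvPolynomial (Fin n) K) :
    (f • θ) g = f * θ g := rfl

theorem mul_coProd_erase {n : ℕ} {A X : Finset ι} (p : ι → MvPolynomial (Fin n) K) {i : ι}
    (hi : i ∈ A) (hX : X ⊆ A.erase i) : p i * coProd (A.erase i) p X = coProd A p X := by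
  have hiX : i ∉ X := fun hh => Finset.notMem_erase i A (hX hh)
  rw [coProd, coProd, Finset.erase_sdiff_comm,
    Finset.mul_prod_erase _ _ (Finset.mem_sdiff.2 ⟨hi, hiX⟩)]

theorem coProd_insert {n : ℕ} (A X : Finset ι) (p : ι → MvPolynomial (Fin n) K) (i : ι) :
    coProd A p (insert i X) = coProd (A.erase i) p X := by
  rw [coProd, coProd, Finset.sdiff_insert, Finset.erase_sdiff_comm]

theorem smul_mem_lineSpan_of_erase {n : ℕ} {A : Finset ι} {p : ι → MvPolynomial (Fin (n + 1)) K}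
    {v : Finset ι → Fin (n + 1) → K} {i : ι} (hi : i ∈ A)
    {θ : Module.End K (MvPolynomial (Fin (n + 1)) K)} (hθ : θ ∈ lineSpan (A.erase i) p v) :
    p i • θ ∈ lineSpan A p v := by
  induction hθ using Submodule.span_induction with
  | mem x hx =>
    obtain rfl | ⟨X, ⟨hX, hXc⟩, rfl⟩ := hx
    · exact Submodule.smul_mem _ _ (one_mem_lineSpan A p v)
    · convert lineOperator_mem_lineSpan p v (hX.trans (Finset.erase_subset i A)) hXc using 1
      refine LinearMap.ext fun g => ?_
      rw [End_smul_apply, lineOperator_apply, lineOperator_apply, mul_smul_comm,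
        mul_coProd_erase p hi hX]
  | zero => rw [smul_zero]; exact zero_mem _
  | add x y _ _ hx hy => rw [smul_add]; exact add_mem hx hy
  | smul f x _ hx => rw [smul_comm]; exact Submodule.smul_mem _ _ hx

namespace IsGenericFamily

variable {n : ℕ} {A : Finset ι} {p : ι → MvPolynomial (Fin (n + 1)) K}
  {v : Finset ι → Fin (n + 1) → K}

/-- If `X` meets `J`, the product over `J` vanishes at `v X`; otherwise `J` lies in `A \ X` and its
product divides `coProd A p X`. -/
theorem prod_dvd_of_mem_lineSpan (h : IsGenericFamily A p v)
    {θ : Module.End K (MvPolynomial (Fin (n + 1)) K)} (hθ : θ ∈ lineSpan A p v) {J : Finset ι}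
    (hJ : J ⊆ A) : ∏ i ∈ J, p i ∣ θ (∏ i ∈ J, p i) := by
  induction hθ using Submodule.span_induction with
  | mem x hx =>
    obtain rfl | ⟨X, ⟨hX, hXc⟩, rfl⟩ := hx
    · exact dvd_rfl
    · rw [lineOperator_apply]
      by_cases hd : Disjoint X J
      · refine dvd_smul_of_dvd _ ?_
        exact Finset.prod_dvd_prod_of_subset _ _ _ fun i hi =>
          Finset.mem_sdiff.2 ⟨hJ hi, Finset.disjoint_right.1 hd hi⟩
      · rw [h.eval_prod_eq_zero hX hXc hd, zero_smul]
        exact dvd_zero _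
  | zero => exact dvd_zero _
  | add x y _ _ hx hy => exact dvd_add hx hy
  | smul f x _ hx => exact Dvd.dvd.mul_left hx f

theorem exists_lift_of_mem_lineSpan {p : ι → MvPolynomial (Fin (n + 1 + 1)) K}
    {v : Finset ι → Fin (n + 1 + 1) → K}
    (h : IsGenericFamily A p v) {i : ι} (hi : i ∈ A) (ρ : HyperplaneRestriction (p i))
    {θ : Module.End K (MvPolynomial (Fin (n + 1)) K)}
    (hθ : θ ∈ lineSpan (A.erase i) (fun j => ρ.res (p j)) (fun X => ρ.proj (v (insert i X)))) :
    ∃ ψ ∈ lineSpan A p v, ∀ g, ρ.res (ψ g) = θ (ρ.res g) := by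
  induction hθ using Submodule.span_induction with
  | mem x hx =>
    obtain rfl | ⟨X, ⟨hX, hXc⟩, rfl⟩ := hx
    · exact ⟨1, one_mem_lineSpan A p v, fun _ => rfl⟩
    · refine ⟨lineOperator A p v (insert i X), lineOperator_mem_lineSpan p v
        (Finset.insert_subset hi (hX.trans (Finset.erase_subset _ _))) ?_, fun g => ?_⟩
      · rw [Finset.card_insert_of_notMem fun hh => Finset.notMem_erase i A (hX hh), hXc]
      · rw [lineOperator_apply, lineOperator_apply, h.eval_restrict hi ρ hX hXc, map_smul,
          coProd_insert, coProd, coProd, map_prod]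
  | zero => exact ⟨0, zero_mem _, fun g => by simp⟩
  | add x y _ _ hx hy =>
    obtain ⟨a, ha, ha'⟩ := hx
    obtain ⟨b, hb, hb'⟩ := hy
    exact ⟨a + b, add_mem ha hb, fun g => by simp [ha', hb']⟩
  | smul f x _ hx =>
    obtain ⟨a, ha, ha'⟩ := hx
    exact ⟨ρ.lift f • a, Submodule.smul_mem _ _ ha, fun g => by
      rw [End_smul_apply, End_smul_apply, map_mul, ρ.res_lift, ha']⟩

/-- Here the complements `A \ X` have `m` elements, so the interpolation polynomials are themselves
among the products on which `φ` is diagonal. -/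
theorem exists_mem_lineSpan_of_card_eq {m : ℕ} (h : IsGenericFamily A p v)
    (hA : A.card = n + m) (φ : Module.End K (MvPolynomial (Fin (n + 1)) K))
    (hφ : ∀ J ⊆ A, J.card = m → ∏ i ∈ J, p i ∣ φ (∏ i ∈ J, p i)) :
    ∃ ψ ∈ lineSpan A p v, ∀ g, IsHomogeneous g m → φ g = ψ g := by
  have hdvd : ∀ X ∈ A.powersetCard n, ∃ q, φ (coProd A p X) = coProd A p X * q := by
    intro X hX
    rw [Finset.mem_powersetCard] at hX
    exact hφ _ Finset.sdiff_subset (by rw [Finset.card_sdiff_of_subset hX.1]; omega)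
  choose! q hq using hdvd
  refine ⟨∑ X ∈ A.powersetCard n,
    ((eval (v X) (coProd A p X))⁻¹ • q X) • lineOperator A p v X,
    sum_mem fun X hX => Submodule.smul_mem _ _ ?_, fun g hg => ?_⟩
  · rw [Finset.mem_powersetCard] at hX
    exact lineOperator_mem_lineSpan p v hX.1 hX.2
  · conv_lhs => rw [h.interpolation hA hg]
    rw [map_sum, LinearMap.sum_apply]
    refine Finset.sum_congr rfl fun X hX => ?_
    rw [map_smul, hq X hX, End_smul_apply, lineOperator_apply, smul_mul_smul_comm, mul_comm,
      div_eq_inv_mul]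

/-- Interpolation on `n + m` hyperplanes other than `i` writes `g` through products of `m` forms;
times `p i`, these become products of `m + 1` distinct forms, to which `hφ` applies. -/
theorem dvd_of_homogeneous {m : ℕ} (h : IsGenericFamily A p v) {i : ι} (hi : i ∈ A)
    (hA : n + m + 1 ≤ A.card) (φ : Module.End K (MvPolynomial (Fin (n + 1)) K))
    (hφ : ∀ J ⊆ A, J.card = m + 1 → ∏ i ∈ J, p i ∣ φ (∏ i ∈ J, p i))
    {g : MvPolynomial (Fin (n + 1)) K} (hg : g.IsHomogeneous m) : p i ∣ φ (p i * g) := by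
  obtain ⟨C, hC, hCc⟩ := Finset.exists_subset_card_eq
    (show n + m ≤ (A.erase i).card by rw [Finset.card_erase_of_mem hi]; omega)
  have hCA := hC.trans (Finset.erase_subset i A)
  rw [(h.mono hCA).interpolation hCc hg, Finset.mul_sum, map_sum]
  refine Finset.dvd_sum fun X hX => ?_
  rw [Finset.mem_powersetCard] at hX
  have hiX : i ∉ C \ X := fun hh => Finset.notMem_erase i A (hC (Finset.mem_sdiff.1 hh).1)
  rw [mul_smul_comm, map_smul, coProd, ← Finset.prod_insert hiX]
  refine dvd_smul_of_dvd _ ?_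
  refine dvd_trans (Finset.dvd_prod_of_mem p (Finset.mem_insert_self i (C \ X))) (hφ _
    (Finset.insert_subset hi (Finset.sdiff_subset.trans hCA)) ?_)
  rw [Finset.card_insert_of_notMem hiX, Finset.card_sdiff_of_subset hX.1]
  omega

end IsGenericFamily

/-- Any linear left inverse of multiplication by `l` will do. It makes division by `l` a globally
defined endomorphism, as the induction below requires. -/
theorem exists_linearMap_mul_eq {n : ℕ} {l : MvPolynomial (Fin n) K} (hl : l ≠ 0) :
    ∃ d : Module.End K (MvPolynomial (Fin n) K), ∀ q, d (l * q) = q := by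
  obtain ⟨d, hd⟩ := (LinearMap.mulLeft K l).exists_leftInverse_of_injective
    (LinearMap.ker_eq_bot.2 (mul_right_injective₀ hl))
  exact ⟨d, fun q => DFunLike.congr_fun hd q⟩

/-- Induction on the dimension and on the excess `t` of hyperplanes. The map induced by `φ` on a
hyperplane is matched by some `ψ₁`, by the case of smaller dimension; then `(φ - ψ₁) / p i`
satisfies the hypothesis for `A.erase i`. The degree is written `m + 1` because `dvd_of_homogeneous`
splits off one factor. -/
theorem IsGenericFamily.exists_mem_lineSpan_succ {n : ℕ} (m : ℕ) : ∀ (t : ℕ) {A : Finset ι}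
    {p : ι → MvPolynomial (Fin (n + 1)) K} {v : Finset ι → Fin (n + 1) → K}
    (_ : IsGenericFamily A p v) (_ : A.card = n + (m + 1) + t)
    (φ : Module.End K (MvPolynomial (Fin (n + 1)) K))
    (_ : ∀ J ⊆ A, J.card = m + 1 → ∏ i ∈ J, p i ∣ φ (∏ i ∈ J, p i)),
    ∃ ψ ∈ lineSpan A p v, ∀ g, IsHomogeneous g (m + 1) → φ g = ψ g := by
  induction n with
  | zero =>
    intro t A p v h hA φ hφ
    -- In one variable the forms of degree `m + 1` are the multiples of a single product, so `φ`
    -- acts on them as multiplication by a polynomial.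
    obtain ⟨J, hJ, hJc⟩ := Finset.exists_subset_card_eq (show m + 1 ≤ A.card by omega)
    obtain ⟨f, hf⟩ := hφ J hJ hJc
    refine ⟨f • 1, Submodule.smul_mem _ _ (one_mem_lineSpan A p v), fun g hg => ?_⟩
    obtain ⟨c, hc⟩ := eq_C_mul_X_pow (hJc ▸ h.isHomogeneous_prod hJ)
    obtain ⟨c', hc'⟩ := eq_C_mul_X_pow hg
    have hne := h.prod_ne_zero (by omega) hJ
    have hc0 : c ≠ 0 := by
      rintro rfl
      rw [C_0, zero_mul] at hc
      exact hne hc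
    have hgJ : g = (c' / c) • ∏ i ∈ J, p i := by
      rw [hc, hc', smul_eq_C_mul, ← mul_assoc, ← C_mul, div_mul_cancel₀ _ hc0]
    rw [End_smul_apply, Module.End.one_apply, hgJ, map_smul, hf, mul_smul_comm, mul_comm]
  | succ n ihn =>
    intro t
    induction t with
    | zero =>
      intro A p v h hA φ hφ
      exact h.exists_mem_lineSpan_of_card_eq hA φ hφ
    | succ t iht =>
      intro A p v h hA φ hφ
      obtain ⟨i, hi⟩ : A.Nonempty := Finset.card_pos.1 (by omega)
      have hpi := h.ne_zero (by omega) hi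
      have hA' : (A.erase i).card + 1 = A.card := Finset.card_erase_add_one hi
      have hsub := Finset.erase_subset i A
      obtain ⟨ρ⟩ := nonempty_hyperplaneRestriction (h.isHomogeneous i hi) hpi
      -- `φ` descends to the hyperplane: changing `g` by a multiple of `p i` changes `φ g` by a
      -- multiple of `p i`.
      have hres : ∀ g, IsHomogeneous g (m + 1) → ρ.res (φ (ρ.lift (ρ.res g))) = ρ.res (φ g) := by
        intro g hg
        obtain ⟨q, hq, hgq⟩ := exists_eq_mul_of_dvd (h.isHomogeneous i hi) hpi
          ((ρ.isHomogeneous_lift (ρ.isHomogeneous_res hg)).sub hg)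
          ((ρ.res_eq_zero_iff _).1 (by rw [map_sub, ρ.res_lift, sub_self]))
        rw [← sub_eq_zero, ← map_sub, ← map_sub, hgq, ρ.res_eq_zero_iff]
        exact h.dvd_of_homogeneous hi (by omega) φ hφ hq
      have hr := h.restrict hi ρ
      obtain ⟨θ, hθ, hθφ⟩ := ihn (t + 1) hr (by omega)
        (ρ.res.toLinearMap ∘ₗ φ ∘ₗ ρ.lift.toLinearMap) fun J hJ hJc => by
          have hJh := hJc ▸ h.isHomogeneous_prod (hJ.trans hsub)
          simp only [LinearMap.comp_apply, AlgHom.toLinearMap_apply, ← map_prod]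
          rw [hres _ hJh]
          exact map_dvd ρ.res (hφ J (hJ.trans hsub) hJc)
      obtain ⟨ψ₁, hψ₁, hψθ⟩ := h.exists_lift_of_mem_lineSpan hi ρ hθ
      obtain ⟨d, hd⟩ := exists_linearMap_mul_eq hpi
      have hdiv : ∀ g, IsHomogeneous g (m + 1) → p i * d (φ g - ψ₁ g) = φ g - ψ₁ g := by
        intro g hg
        have h1 : ρ.res (φ g - ψ₁ g) = 0 := by
          rw [map_sub, hψθ, ← hθφ _ (ρ.isHomogeneous_res hg)]
          simp only [LinearMap.comp_apply, AlgHom.toLinearMap_apply]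
          rw [hres g hg, sub_self]
        obtain ⟨q, hq⟩ := (ρ.res_eq_zero_iff _).1 h1
        rw [hq, hd]
      obtain ⟨ψ₂, hψ₂, hψ₂φ⟩ := iht (h.mono hsub) (by omega) (d ∘ₗ (φ - ψ₁))
        fun J hJ hJc => by
          have hJA := hJ.trans hsub
          have h1 := hdiv _ (hJc ▸ h.isHomogeneous_prod hJA)
          obtain ⟨q, hq⟩ := dvd_sub (hφ J hJA hJc) (h.prod_dvd_of_mem_lineSpan hψ₁ hJA)
          -- The product over `J` does not vanish on the hyperplane of `i`, so the factor `p i` must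
          -- come from `q`.
          have h2 : ρ.res q = 0 := by
            have h3 := congrArg ρ.res (h1.trans hq)
            rw [map_mul, (ρ.res_eq_zero_iff _).2 dvd_rfl, zero_mul, map_mul, map_prod] at h3
            exact (mul_eq_zero.1 h3.symm).resolve_left (hr.prod_ne_zero (by omega) hJ)
          obtain ⟨q', rfl⟩ := (ρ.res_eq_zero_iff _).1 h2
          refine ⟨q', mul_left_cancel₀ hpi ?_⟩
          rw [LinearMap.comp_apply, LinearMap.sub_apply, h1, hq, mul_left_comm]
      refine ⟨ψ₁ + p i • ψ₂, add_mem hψ₁ (smul_mem_lineSpan_of_erase hi hψ₂), fun g hg => ?_⟩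
      rw [LinearMap.add_apply, End_smul_apply, ← hψ₂φ g hg, LinearMap.comp_apply,
        LinearMap.sub_apply, hdiv g hg, add_sub_cancel]

/-- On homogeneous polynomials of degree `m`, an operator sending every product of `m` of the forms
to a multiple of itself is a combination of the identity and of the line operators. -/
theorem IsGenericFamily.exists_mem_lineSpan {n m : ℕ} {A : Finset ι}
    {p : ι → MvPolynomial (Fin (n + 1)) K} {v : Finset ι → Fin (n + 1) → K}
    (h : IsGenericFamily A p v) (hA : n + m ≤ A.card)
    (φ : Module.End K (MvPolynomial (Fin (n + 1)) K))
    (hφ : ∀ J ⊆ A, J.card = m → ∏ i ∈ J, p i ∣ φ (∏ i ∈ J, p i)) :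
    ∃ ψ ∈ lineSpan A p v, ∀ g, IsHomogeneous g m → φ g = ψ g := by
  obtain _ | m := m
  · refine ⟨φ 1 • 1, Submodule.smul_mem _ _ (one_mem_lineSpan A p v), fun g hg => ?_⟩
    have hg : g ∈ homogeneousSubmodule (Fin (n + 1)) K 0 := hg
    rw [homogeneousSubmodule_zero, Submodule.mem_one] at hg
    obtain ⟨c, rfl⟩ := hg
    rw [End_smul_apply, Module.End.one_apply, Algebra.algebraMap_eq_smul_one, map_smul,
      mul_smul_one]
  · exact h.exists_mem_lineSpan_succ m (A.card - (n + (m + 1))) (by omega) φ hφ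

end Generation

/-! ### Minimality of generators from the constant terms of relations. -/

section Relations

variable {K : Type*} [Field K]

/-- Writing each family through the other gives two matrices whose product differs from the identity
by relations among the `θ j`. After applying `ε` the product is the identity over `K`, and ranks are
compared. This takes the place of Nakayama's lemma. -/
theorem card_le_card_of_relations {R V κ τ : Type*} [CommRing R] [AddCommGroup V] [Module R V]
    [Fintype κ] [Fintype τ] (ε : R →+* K) {θ : κ → V} {b : τ → V}
    (hspan : Submodule.span R (Set.range b) = Submodule.span R (Set.range θ))
    (hrel : ∀ f : κ → R, ∑ j, f j • θ j = 0 → ∀ j, ε (f j) = 0) :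
    Fintype.card κ ≤ Fintype.card τ := by
  classical
  have h1 : ∀ j, ∃ a : τ → R, ∑ t, a t • b t = θ j := fun j =>
    Submodule.mem_span_range_iff_exists_fun R |>.1
      (hspan ▸ Submodule.subset_span (Set.mem_range_self j))
  have h2 : ∀ t, ∃ c : κ → R, ∑ k, c k • θ k = b t := fun t =>
    Submodule.mem_span_range_iff_exists_fun R |>.1
      (hspan ▸ Submodule.subset_span (Set.mem_range_self t))
  choose a ha using h1
  choose c hc using h2
  have h3 : (Matrix.of fun j t => ε (a j t)) * (Matrix.of fun t k => ε (c t k)) =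
      (1 : Matrix κ κ K) := by
    ext j k
    have := hrel (fun k => (∑ t, a j t * c t k) - if j = k then 1 else 0) (by
      simp only [sub_smul, Finset.sum_smul, Finset.sum_sub_distrib, mul_smul, ite_smul, one_smul,
        zero_smul, Finset.sum_ite_eq, Finset.mem_univ, if_true]
      rw [Finset.sum_comm]
      simp only [← Finset.smul_sum, hc, ha, sub_self]) k
    rw [map_sub, sub_eq_zero, map_sum] at this
    simp only [Matrix.mul_apply, Matrix.of_apply, ← map_mul, this, Matrix.one_apply]
    split_ifs <;> simp
  calc Fintype.card κ = (1 : Matrix κ κ K).rank := Matrix.rank_one.symm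
    _ ≤ _ := h3 ▸ Matrix.rank_mul_le_left _ _
    _ ≤ _ := Matrix.rank_le_card_width _

theorem isMinimalGenerators_of_relations {R V : Type*} [CommRing R] [AddCommGroup V] [Module R V]
    {N : ℕ} (ε : R →+* K) {θ : Fin N → V} {M : Submodule R V}
    (hspan : Submodule.span R (Set.range θ) = M)
    (hrel : ∀ f : Fin N → R, ∑ j, f j • θ j = 0 → ∀ j, ε (f j) = 0) :
    IsMinimalGenerators θ M := by
  refine ⟨hspan, fun i hi => ?_, fun T hT => ?_⟩
  · have himg : θ '' {j | j ≠ i} = θ '' ((Finset.univ.erase i : Finset (Fin N)) : Set (Fin N)) := by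
      congr 1
      ext j
      simp
    rw [himg, Submodule.mem_span_image_finset_iff_exists_fun'] at hi
    obtain ⟨c, hc⟩ := hi
    -- A redundant generator would give a relation with the coefficient `-1`, which `ε` does not
    -- kill.
    have := hrel (fun j => if j = i then -1 else c j) (by
      rw [← Finset.add_sum_erase _ _ (Finset.mem_univ i)]
      rw [Finset.sum_congr rfl fun j hj => by rw [if_neg (Finset.ne_of_mem_erase hj)], hc]
      simp) i
    simp at this
  · have := card_le_card_of_relations (κ := Fin N) (τ := T) ε (b := fun t : T => (t : V))
      (by rw [Subtype.range_coe_subtype, hspan]; exact hT) hrel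
    simpa using this

/-- Restriction of polynomials to the line through `w`. -/
noncomputable def lineRestriction {n : ℕ} (w : Fin n → K) :
    MvPolynomial (Fin n) K →ₐ[K] Polynomial K :=
  aeval fun i => Polynomial.C (w i) * Polynomial.X

theorem lineRestriction_of_isHomogeneous {n d : ℕ} (w : Fin n → K) {g : MvPolynomial (Fin n) K}
    (hg : g.IsHomogeneous d) :
    lineRestriction w g = Polynomial.C (eval w g) * Polynomial.X ^ d := by
  rw [lineRestriction, aeval_def, eval₂_eq', eval_eq', map_sum, Finset.sum_mul]
  refine Finset.sum_congr rfl fun s hs => ?_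
  have hsd : ∑ i, s i = d := by
    rw [← Finsupp.degree_eq_sum]
    by_contra h
    exact mem_support_iff.1 hs (hg.coeff_eq_zero h)
  simp only [mul_pow, Finset.prod_mul_distrib, Finset.prod_pow_eq_pow_sum, hsd, map_mul, map_prod,
    map_pow, Polynomial.algebraMap_eq]
  rw [mul_assoc]

theorem coeff_zero_lineRestriction {n : ℕ} (w : Fin n → K) (g : MvPolynomial (Fin n) K) :
    (lineRestriction w g).coeff 0 = constantCoeff g := by
  have : (Polynomial.aeval (0 : K)).comp (lineRestriction w) = aeval (fun _ => (0 : K)) := by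
    ext i
    simp [lineRestriction]
  have h2 := DFunLike.congr_fun this g
  rw [AlgHom.comp_apply, Polynomial.coe_aeval_eq_eval, ← Polynomial.coeff_zero_eq_eval_zero] at h2
  rw [h2, aeval_eq_eval]
  simp [constantCoeff_eq, ← Pi.zero_def]

end Relations

/-! ### Reduction to the lines meeting `B`, and relations among line operators. -/

section MeetingLines

variable {K : Type*} [Field K] {ι : Type*} [DecidableEq ι]

/-- The `n`-subsets of `A` meeting `B`. -/
def meetingSubsets (A B : Finset ι) (n : ℕ) : Finset (Finset ι) :=
  (A.powersetCard n).filter fun X => ¬ Disjoint X B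

theorem mem_meetingSubsets {A B X : Finset ι} {n : ℕ} :
    X ∈ meetingSubsets A B n ↔ X ⊆ A ∧ X.card = n ∧ ¬ Disjoint X B := by
  rw [meetingSubsets, Finset.mem_filter, Finset.mem_powersetCard, and_assoc]

theorem card_meetingSubsets {A B : Finset ι} (hB : B ⊆ A) (n : ℕ) :
    (meetingSubsets A B n).card = A.card.choose n - (A.card - B.card).choose n := by
  have h1 : (A.powersetCard n).filter (fun X => Disjoint X B) = (A \ B).powersetCard n := by
    ext X
    rw [Finset.mem_filter, Finset.mem_powersetCard, Finset.mem_powersetCard, Finset.subset_sdiff]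
    tauto
  have h2 := Finset.card_filter_add_card_filter_not (s := A.powersetCard n)
    (fun X => Disjoint X B)
  rw [h1, Finset.card_powersetCard, Finset.card_powersetCard, Finset.card_sdiff_of_subset hB] at h2
  rw [meetingSubsets]
  omega

theorem coProd_mul_coProd {n : ℕ} {A C Y : Finset ι} (p : ι → MvPolynomial (Fin n) K)
    (hC : C ⊆ A) (hY : Y ⊆ C) : coProd A p C * coProd C p Y = coProd A p Y := by
  rw [coProd, coProd, coProd, ← Finset.prod_union]
  · congr 1
    rw [Finset.sdiff_union_sdiff_cancel hC hY]
  · exact Finset.disjoint_left.2 fun i hi hi' =>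
      (Finset.mem_sdiff.1 hi).2 (Finset.mem_sdiff.1 hi').1

namespace IsGenericFamily

variable {n m : ℕ} {A B : Finset ι} {p : ι → MvPolynomial (Fin (n + 1)) K}
  {v : Finset ι → Fin (n + 1) → K}

/-- When `X` misses `B`, interpolate on `D = X ∪ B` and multiply by `coProd A p D`: the
multiplication operator becomes a combination of the line operators of the `n`-subsets of `D`. Among
these only `X` misses `B`, so its operator can be solved for. -/
theorem exists_sum_meeting_of_lineOperator (h : IsGenericFamily A p v) (hB : B ⊆ A)
    (hBm : B.card = m) {X : Finset ι} (hX : X ⊆ A) (hXc : X.card = n) :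
    ∃ (f : MvPolynomial (Fin (n + 1)) K) (c : Finset ι → MvPolynomial (Fin (n + 1)) K),
      ∀ g, IsHomogeneous g m →
        lineOperator A p v X g =
          f * g + ∑ Y ∈ meetingSubsets A B n, c Y * lineOperator A p v Y g := by
  by_cases hd : Disjoint X B
  · set D := X ∪ B with hD
    have hDA : D ⊆ A := Finset.union_subset hX hB
    have hDc : D.card = n + m := by rw [hD, Finset.card_union_of_disjoint hd, hXc, hBm]
    have hXD : X ∈ D.powersetCard n :=
      Finset.mem_powersetCard.2 ⟨Finset.subset_union_left, hXc⟩
    have hD' := h.mono hDA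
    set a : K := eval (v X) (coProd D p X) with ha
    have ha0 : a ≠ 0 := hD'.eval_coProd_ne_zero Finset.subset_union_left hXc
    refine ⟨C a * coProd A p D, fun Y => if Y ⊆ D ∧ Y ≠ X then
      - C (a * (eval (v Y) (coProd D p Y))⁻¹) else 0, fun g hg => ?_⟩
    have h1 : (D.powersetCard n).erase X =
        (meetingSubsets A B n).filter fun Y => Y ⊆ D ∧ Y ≠ X := by
      ext Y
      rw [Finset.mem_erase, Finset.mem_powersetCard, Finset.mem_filter, mem_meetingSubsets]
      refine ⟨fun ⟨h1, h2, h3⟩ => ⟨⟨h2.trans hDA, h3, fun h4 => h1 ?_⟩, h2, h1⟩,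
        fun ⟨⟨_, h1, _⟩, h2, h3⟩ => ⟨h3, h2, h1⟩⟩
      refine Finset.eq_of_subset_of_card_le (fun i hi => ?_) (by omega)
      exact (Finset.mem_union.1 (h2 hi)).resolve_right (Finset.disjoint_left.1 h4 hi)
    have h2 : coProd A p D * g = ∑ Y ∈ D.powersetCard n,
        C (eval (v Y) (coProd D p Y))⁻¹ * lineOperator A p v Y g := by
      conv_lhs => rw [hD'.interpolation hDc hg, Finset.mul_sum]
      refine Finset.sum_congr rfl fun Y hY => ?_
      rw [mul_smul_comm, coProd_mul_coProd p hDA (Finset.mem_powersetCard.1 hY).1,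
        lineOperator_apply, ← smul_eq_C_mul, smul_smul, div_eq_inv_mul]
    simp only [ite_mul, zero_mul, ← Finset.sum_filter]
    rw [← h1, mul_assoc, h2, ← Finset.add_sum_erase _ _ hXD, mul_add, Finset.mul_sum, add_assoc,
      ← Finset.sum_add_distrib, Finset.sum_eq_zero, add_zero, ← mul_assoc, ← C_mul,
      mul_inv_cancel₀ ha0, C_1, one_mul]
    intro Y _
    rw [C_mul]
    ring
  · refine ⟨0, fun Y => if Y = X then 1 else 0, fun g _ => ?_⟩
    simp only [ite_mul, zero_mul, one_mul, zero_add, Finset.sum_ite_eq']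
    rw [if_pos (mem_meetingSubsets.2 ⟨hX, hXc, hd⟩)]

theorem exists_sum_meeting (h : IsGenericFamily A p v) (hB : B ⊆ A) (hBm : B.card = m)
    {θ : Module.End K (MvPolynomial (Fin (n + 1)) K)} (hθ : θ ∈ lineSpan A p v) :
    ∃ (f : MvPolynomial (Fin (n + 1)) K) (c : Finset ι → MvPolynomial (Fin (n + 1)) K),
      ∀ g, IsHomogeneous g m →
        θ g = f * g + ∑ Y ∈ meetingSubsets A B n, c Y * lineOperator A p v Y g := by
  induction hθ using Submodule.span_induction with
  | mem x hx =>
    obtain rfl | ⟨X, ⟨hX, hXc⟩, rfl⟩ := hx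
    · exact ⟨1, fun _ => 0, fun g _ => by simp⟩
    · exact h.exists_sum_meeting_of_lineOperator hB hBm hX hXc
  | zero => exact ⟨0, fun _ => 0, fun g _ => by simp⟩
  | add x y _ _ hx hy =>
    obtain ⟨f, c, hf⟩ := hx
    obtain ⟨f', c', hf'⟩ := hy
    refine ⟨f + f', c + c', fun g hg => ?_⟩
    simp only [LinearMap.add_apply, hf g hg, hf' g hg, Pi.add_apply, add_mul,
      Finset.sum_add_distrib]
    ring
  | smul a x _ hx =>
    obtain ⟨f, c, hf⟩ := hx
    refine ⟨a * f, fun Y => a * c Y, fun g hg => ?_⟩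
    simp only [End_smul_apply, hf g hg, mul_add, Finset.mul_sum, mul_assoc]

theorem lineOperator_prod_eq_zero (h : IsGenericFamily A p v) {X : Finset ι}
    (hX : X ∈ meetingSubsets A B n) : lineOperator A p v X (∏ i ∈ B, p i) = 0 := by
  obtain ⟨h1, h2, h3⟩ := mem_meetingSubsets.1 hX
  rw [lineOperator_apply, h.eval_prod_eq_zero h1 h2 h3, zero_smul]

/-- On the line through `v Y` every `coProd A p X` with `X ≠ Y` vanishes, so `c Y` vanishes on that
line, in particular at the origin. -/
theorem constantCoeff_eq_zero_of_relation (h : IsGenericFamily A p v) {s : Finset (Finset ι)}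
    (hs : s ⊆ A.powersetCard n) (hA : n ≤ A.card) {c : Finset ι → MvPolynomial (Fin (n + 1)) K}
    (hc : ∀ g, IsHomogeneous g m → ∑ X ∈ s, c X * lineOperator A p v X g = 0)
    {Y : Finset ι} (hY : Y ∈ s) : constantCoeff (c Y) = 0 := by
  have hs' : ∀ X ∈ s, X ⊆ A ∧ X.card = n := fun X hX => Finset.mem_powersetCard.1 (hs hX)
  obtain ⟨hYA, hYc⟩ := hs' Y hY
  obtain ⟨j, hj⟩ := Function.ne_iff.1 (h.line_ne_zero Y hYA hYc)
  -- The test form is a power of a coordinate that is nonzero at `v Y`.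
  have h1 := congrArg (lineRestriction (v Y)) (hc (X j ^ m) (isHomogeneous_X_pow j m))
  rw [map_sum, map_zero, Finset.sum_eq_single Y] at h1
  · rw [lineOperator_apply, map_mul, map_smul, lineRestriction_of_isHomogeneous (v Y)
      (h.isHomogeneous_coProd hYA (m := A.card - n) (by omega)), mul_eq_zero] at h1
    have h2 := h1.resolve_right (by
      rw [map_pow, eval_X]
      refine smul_ne_zero (pow_ne_zero _ hj) (mul_ne_zero ?_ (pow_ne_zero _ Polynomial.X_ne_zero))
      exact Polynomial.C_ne_zero.2 (h.eval_coProd_ne_zero hYA hYc))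
    rw [← coeff_zero_lineRestriction (v Y), h2, Polynomial.coeff_zero]
  · intro X hX hne
    obtain ⟨hXA, hXc⟩ := hs' X hX
    rw [lineOperator_apply, map_mul, map_smul, lineRestriction_of_isHomogeneous (v Y)
      (h.isHomogeneous_coProd hXA (m := A.card - n) (by omega)),
      h.eval_coProd_eq_zero hYA hXc hYc hne.symm, map_zero, zero_mul, smul_zero, mul_zero]
  · exact fun hh => absurd hY hh

end IsGenericFamily

end MeetingLines

/-! ### Operators of order `m` as linear maps on forms of degree `m`. -/

section Operators

variable {K : Type*} [Field K] {n : ℕ}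

/-- The partial derivative as an endomorphism. -/
noncomputable def partialEnd (i : Fin n) : Module.End K (MvPolynomial (Fin n) K) :=
  ((pderiv i : Derivation K (MvPolynomial (Fin n) K) (MvPolynomial (Fin n) K)) :
    Module.End K (MvPolynomial (Fin n) K))

theorem partialEnd_apply (i : Fin n) (g : MvPolynomial (Fin n) K) :
    partialEnd i g = pderiv i g := rfl

theorem commute_partialEnd (i j : Fin n) :
    Commute (partialEnd i : Module.End K (MvPolynomial (Fin n) K)) (partialEnd j) := by
  have h : ⁅(pderiv i : Derivation K (MvPolynomial (Fin n) K) (MvPolynomial (Fin n) K)),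
      (pderiv j : Derivation K (MvPolynomial (Fin n) K) (MvPolynomial (Fin n) K))⁆ = 0 := by
    refine derivation_ext fun k => ?_
    rw [Derivation.commutator_apply, pderiv_X, pderiv_X]
    simp only [Pi.single_apply]
    split_ifs <;> simp
  refine LinearMap.ext fun g => ?_
  have := DFunLike.congr_fun h g
  rw [Derivation.commutator_apply, Derivation.zero_apply, sub_eq_zero] at this
  exact this

theorem partialPow_eq (α : Fin n →₀ ℕ) : (partialPow α : Module.End K (MvPolynomial (Fin n) K)) =
    ((List.finRange n).map fun i => partialEnd i ^ α i).prod := by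
  rw [partialPow, List.ofFn_eq_map]
  rfl

theorem partialPow_zero : (partialPow 0 : Module.End K (MvPolynomial (Fin n) K)) = 1 := by
  rw [partialPow_eq]
  exact List.prod_eq_one (by simp)

theorem partialPow_add (α β : Fin n →₀ ℕ) :
    (partialPow (α + β) : Module.End K (MvPolynomial (Fin n) K)) =
      partialPow α * partialPow β := by
  simp only [partialPow_eq, Finsupp.add_apply]
  induction List.finRange n with
  | nil => simp
  | cons i l ih =>
    have hc : Commute ((partialEnd i : Module.End K (MvPolynomial (Fin n) K)) ^ β i)
        (l.map fun j => partialEnd j ^ α j).prod := by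
      refine Commute.list_prod_right _ _ fun x hx => ?_
      obtain ⟨j, -, rfl⟩ := List.mem_map.1 hx
      exact (commute_partialEnd i j).pow_pow _ _
    simp only [List.map_cons, List.prod_cons, ih]
    rw [pow_add, mul_assoc, mul_assoc, ← mul_assoc _ _ (List.prod _), hc.eq, mul_assoc]

theorem partialPow_single (i : Fin n) :
    (partialPow (Finsupp.single i 1) : Module.End K (MvPolynomial (Fin n) K)) = partialEnd i := by
  rw [partialPow_eq, List.prod_map_eq_pow_single i]
  · rw [List.count_eq_one_of_mem (List.nodup_finRange n) (List.mem_finRange i)]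
    simp
  · intro j hj _
    rw [Finsupp.single_eq_of_ne hj, pow_zero]

theorem exists_eq_add_single {m : ℕ} {α : Fin n →₀ ℕ} (hα : α.degree = m + 1) :
    ∃ (i : Fin n) (α' : Fin n →₀ ℕ), α = α' + Finsupp.single i 1 ∧ α'.degree = m := by
  have h0 : α ≠ 0 := by
    rintro rfl
    simp at hα
  obtain ⟨i, hi⟩ := Finsupp.ne_iff.1 h0
  have h1 : α = (α - Finsupp.single i 1) + Finsupp.single i 1 := by
    refine (tsub_add_cancel_of_le ?_).symm
    rw [Finsupp.single_le_iff]
    exact Nat.one_le_iff_ne_zero.2 hi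
  refine ⟨i, _, h1, ?_⟩
  have h2 := congrArg Finsupp.degree h1
  rw [map_add, Finsupp.degree_single, hα] at h2
  omega

/-- The constant `∂^α x^α`. -/
noncomputable def monomialWeight (K : Type*) [Field K] {n : ℕ} (α : Fin n →₀ ℕ) : K :=
  coeff 0 (partialPow α (monomial α (1 : K)))

/-- The constant is `α!`, nonzero in characteristic zero. This duality between `∂^α` and `x^β` lets
the coefficients of an operator be read off from its values on monomials. -/
theorem partialPow_monomial_aux [CharZero K] (m : ℕ) : ∀ α : Fin n →₀ ℕ, α.degree = m →
    ∃ c : K, c ≠ 0 ∧ ∀ β : Fin n →₀ ℕ, β.degree ≤ m →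
      partialPow α (monomial β (1 : K)) = if β = α then C c else 0 := by
  induction m with
  | zero =>
    intro α hα
    obtain rfl : α = 0 := (Finsupp.degree_eq_zero_iff α).1 hα
    refine ⟨1, one_ne_zero, fun β hβ => ?_⟩
    obtain rfl : β = 0 := (Finsupp.degree_eq_zero_iff β).1 (Nat.le_zero.1 hβ)
    rw [partialPow_zero, if_pos rfl]
    rfl
  | succ m ih =>
    intro α hα
    obtain ⟨i, α', rfl, hα'⟩ := exists_eq_add_single hα
    obtain ⟨c, hc, hcβ⟩ := ih α' hα'
    refine ⟨(α' i + 1 : ℕ) * c, mul_ne_zero (Nat.cast_ne_zero.2 (Nat.succ_ne_zero _)) hc,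
      fun β hβ => ?_⟩
    rw [partialPow_add, partialPow_single, Module.End.mul_apply, partialEnd_apply, pderiv_monomial]
    by_cases hi : β i = 0
    · rw [hi, Nat.cast_zero, mul_zero, monomial_zero, map_zero, if_neg]
      rintro rfl
      simp at hi
    · have h1 : β = (β - Finsupp.single i 1) + Finsupp.single i 1 := by
        refine (tsub_add_cancel_of_le ?_).symm
        rw [Finsupp.single_le_iff]
        exact Nat.one_le_iff_ne_zero.2 hi
      set β' := β - Finsupp.single i 1 with hβ'
      have h2 : β'.degree ≤ m := by
        rw [h1, map_add, Finsupp.degree_single] at hβ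
        omega
      have h3 : (monomial β' (1 * (β i : K))) = (β i : K) • monomial β' (1 : K) := by
        rw [smul_monomial, one_mul, smul_eq_mul, mul_one]
      rw [h3, map_smul, hcβ β' h2]
      by_cases h4 : β' = α'
      · rw [if_pos h4, if_pos (by rw [h1, h4]), smul_eq_C_mul, ← C_mul, h1, h4]
        simp
      · rw [if_neg h4, if_neg (fun h5 => h4 (add_right_cancel (h1.symm.trans h5))), smul_zero]

theorem monomialWeight_ne_zero [CharZero K] (α : Fin n →₀ ℕ) : monomialWeight K α ≠ 0 := by
  obtain ⟨c, hc, h⟩ := partialPow_monomial_aux (K := K) _ α rfl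
  rw [monomialWeight, h α le_rfl, if_pos rfl, coeff_C, if_pos rfl]
  exact hc

theorem partialPow_monomial [CharZero K] {α β : Fin n →₀ ℕ} (h : β.degree ≤ α.degree) :
    partialPow α (monomial β (1 : K)) = if β = α then C (monomialWeight K α) else 0 := by
  obtain ⟨c, -, hc⟩ := partialPow_monomial_aux (K := K) _ α rfl
  rw [monomialWeight, hc α le_rfl, if_pos rfl, coeff_C, if_pos rfl, hc β h]

theorem linearMap_congr_of_monomials {m : ℕ} {φ ψ : Module.End K (MvPolynomial (Fin n) K)}
    (h : ∀ α : Fin n →₀ ℕ, α.degree = m → φ (monomial α 1) = ψ (monomial α 1))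
    {g : MvPolynomial (Fin n) K} (hg : g.IsHomogeneous m) : φ g = ψ g := by
  rw [← support_sum_monomial_coeff g, map_sum, map_sum]
  refine Finset.sum_congr rfl fun α hα => ?_
  have hαm : α.degree = m := by
    by_contra hne
    exact mem_support_iff.1 hα (hg.coeff_eq_zero hne)
  rw [show monomial α (coeff α g) = coeff α g • monomial α (1 : K) by
    rw [smul_monomial, smul_eq_mul, mul_one], map_smul, map_smul, h α hαm]

theorem apply_eq_zero_of_lt [CharZero K] {m d : ℕ} (hd : d < m)
    {θ : Module.End K (MvPolynomial (Fin n) K)} (hθ : θ ∈ homogeneousOperators K n m)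
    {g : MvPolynomial (Fin n) K} (hg : g.IsHomogeneous d) : θ g = 0 := by
  induction hθ using Submodule.span_induction with
  | mem x hx =>
    obtain ⟨α, hα, rfl⟩ := hx
    refine linearMap_congr_of_monomials (ψ := 0) (fun β hβ => ?_) hg
    rw [partialPow_monomial (by omega), if_neg (fun h => by rw [h] at hβ; omega)]
    rfl
  | zero => rfl
  | add x y _ _ hx hy => rw [LinearMap.add_apply, hx, hy, add_zero]
  | smul f x _ hx => rw [End_smul_apply, hx, mul_zero]

/-- The operator of order `m` acting on homogeneous polynomials of degree `m` as `φ`. -/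
noncomputable def operatorOf (m : ℕ) (φ : Module.End K (MvPolynomial (Fin n) K)) :
    Module.End K (MvPolynomial (Fin n) K) :=
  ∑ α ∈ Finset.univ.finsuppAntidiag m,
    ((monomialWeight K α)⁻¹ • φ (monomial α 1)) • partialPow α

theorem mem_finsuppAntidiag_univ {m : ℕ} {α : Fin n →₀ ℕ} :
    α ∈ Finset.univ.finsuppAntidiag m ↔ α.degree = m := by
  rw [Finset.mem_finsuppAntidiag, Finsupp.degree_eq_sum]
  simp

theorem operatorOf_mem (m : ℕ) (φ : Module.End K (MvPolynomial (Fin n) K)) :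
    operatorOf m φ ∈ homogeneousOperators K n m := by
  refine sum_mem fun α hα => Submodule.smul_mem _ _ ?_
  exact Submodule.subset_span ⟨α, mem_finsuppAntidiag_univ.1 hα, rfl⟩

theorem operatorOf_apply [CharZero K] {m : ℕ} (φ : Module.End K (MvPolynomial (Fin n) K))
    {g : MvPolynomial (Fin n) K} (hg : g.IsHomogeneous m) : operatorOf m φ g = φ g := by
  refine linearMap_congr_of_monomials (fun β hβ => ?_) hg
  rw [operatorOf, LinearMap.sum_apply, Finset.sum_eq_single β]
  · rw [End_smul_apply, partialPow_monomial le_rfl, if_pos rfl, mul_comm, ← smul_eq_C_mul,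
      smul_smul, mul_inv_cancel₀ (monomialWeight_ne_zero β), one_smul]
  · intro α hα hne
    rw [mem_finsuppAntidiag_univ] at hα
    rw [End_smul_apply, partialPow_monomial (by omega), if_neg hne.symm, mul_zero]
  · exact fun h => absurd (mem_finsuppAntidiag_univ.2 hβ) h

theorem operatorOf_eq_self [CharZero K] {m : ℕ} {θ : Module.End K (MvPolynomial (Fin n) K)}
    (hθ : θ ∈ homogeneousOperators K n m) : operatorOf m θ = θ := by
  induction hθ using Submodule.span_induction with
  | mem x hx =>
    obtain ⟨α, hα, rfl⟩ := hx
    rw [operatorOf, Finset.sum_eq_single α]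
    · rw [partialPow_monomial le_rfl, if_pos rfl, smul_eq_C_mul, ← C_mul,
        inv_mul_cancel₀ (monomialWeight_ne_zero α), C_1, one_smul]
    · intro β hβ hne
      rw [mem_finsuppAntidiag_univ] at hβ
      rw [partialPow_monomial (by omega), if_neg hne, smul_zero, zero_smul]
    · exact fun h => absurd (mem_finsuppAntidiag_univ.2 hα) h
  | zero => simp [operatorOf]
  | add x y _ _ hx hy =>
    conv_rhs => rw [← hx, ← hy]
    simp only [operatorOf, LinearMap.add_apply, smul_add, add_smul, Finset.sum_add_distrib]
  | smul f x _ hx =>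
    conv_rhs => rw [← hx]
    simp only [operatorOf, End_smul_apply, Finset.smul_sum, smul_smul]
    refine Finset.sum_congr rfl fun α _ => ?_
    rw [mul_smul_comm]

theorem operator_ext [CharZero K] {m : ℕ} {θ η : Module.End K (MvPolynomial (Fin n) K)}
    (hθ : θ ∈ homogeneousOperators K n m) (hη : η ∈ homogeneousOperators K n m)
    (h : ∀ g, IsHomogeneous g m → θ g = η g) : θ = η := by
  rw [← operatorOf_eq_self hθ, ← operatorOf_eq_self hη]
  refine Finset.sum_congr rfl fun α hα => ?_
  rw [h _ (isHomogeneous_monomial _ (mem_finsuppAntidiag_univ.1 hα))]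

/-- The commutator of an operator with the multiplication by a polynomial. -/
noncomputable def commutatorWith (l : MvPolynomial (Fin n) K)
    (θ : Module.End K (MvPolynomial (Fin n) K)) : Module.End K (MvPolynomial (Fin n) K) :=
  θ * LinearMap.mulLeft K l - LinearMap.mulLeft K l * θ

theorem commutatorWith_apply (l : MvPolynomial (Fin n) K)
    (θ : Module.End K (MvPolynomial (Fin n) K)) (g : MvPolynomial (Fin n) K) :
    commutatorWith l θ g = θ (l * g) - l * θ g := rfl

theorem mul_partialEnd_mem {m : ℕ} {θ : Module.End K (MvPolynomial (Fin n) K)}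
    (hθ : θ ∈ homogeneousOperators K n m) (i : Fin n) :
    θ * partialEnd i ∈ homogeneousOperators K n (m + 1) := by
  induction hθ using Submodule.span_induction with
  | mem x hx =>
    obtain ⟨α, hα, rfl⟩ := hx
    rw [← partialPow_single, ← partialPow_add]
    exact Submodule.subset_span ⟨_, by rw [map_add, Finsupp.degree_single, hα], rfl⟩
  | zero => rw [zero_mul]; exact zero_mem _
  | add x y _ _ hx hy => rw [add_mul]; exact add_mem hx hy
  | smul f x _ hx =>
    rw [show (f • x) * partialEnd i = f • (x * partialEnd i) from LinearMap.ext fun _ => rfl]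
    exact Submodule.smul_mem _ f hx

theorem commutatorWith_mem_of_partialPow {m : ℕ} {l : MvPolynomial (Fin n) K}
    (hl : l.IsHomogeneous 1) : ∀ α : Fin n →₀ ℕ, α.degree = m + 1 →
    commutatorWith l (partialPow α) ∈ homogeneousOperators K n m := by
  obtain ⟨a, ha⟩ := exists_eq_sum_C_mul_X hl
  have hpd : ∀ i, pderiv i l = C (a i) := by
    intro i
    rw [ha, map_sum, Finset.sum_eq_single i]
    · simp
    · intro j _ hj
      rw [pderiv_C_mul, pderiv_X_of_ne hj, mul_zero]
    · exact fun h => absurd (Finset.mem_univ i) h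
  -- Leibniz: `∂ᵢ` commutes with multiplication by `l` up to the constant `a i`.
  have hstep : ∀ (α : Fin n →₀ ℕ) (i : Fin n),
      commutatorWith l (partialPow (K := K) (α + Finsupp.single i 1)) =
      commutatorWith l (partialPow (K := K) α) * partialEnd (K := K) i +
        (C (a i) : MvPolynomial (Fin n) K) • partialPow (K := K) α := by
    intro α i
    refine LinearMap.ext fun g => ?_
    simp only [partialPow_add, partialPow_single, commutatorWith_apply, LinearMap.add_apply,
      Module.End.mul_apply, End_smul_apply, partialEnd_apply, Derivation.leibniz, hpd,
      smul_eq_mul, map_add]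
    rw [mul_comm g, ← smul_eq_C_mul, map_smul, ← smul_eq_C_mul]
    ring
  induction m with
  | zero =>
    intro α hα
    obtain ⟨i, α', rfl, hα'⟩ := exists_eq_add_single hα
    obtain rfl : α' = 0 := (Finsupp.degree_eq_zero_iff α').1 hα'
    rw [hstep]
    have h0 : commutatorWith l (partialPow 0) = 0 := by
      refine LinearMap.ext fun g => ?_
      rw [commutatorWith_apply, partialPow_zero]
      simp
    rw [h0, zero_mul, zero_add]
    exact Submodule.smul_mem _ _ (Submodule.subset_span ⟨0, hα', rfl⟩)
  | succ m ih =>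
    intro α hα
    obtain ⟨i, α', rfl, hα'⟩ := exists_eq_add_single hα
    rw [hstep]
    exact add_mem (mul_partialEnd_mem (ih α' hα') i)
      (Submodule.smul_mem _ _ (Submodule.subset_span ⟨α', hα', rfl⟩))

theorem commutatorWith_mem {m : ℕ} {l : MvPolynomial (Fin n) K} (hl : l.IsHomogeneous 1)
    {θ : Module.End K (MvPolynomial (Fin n) K)} (hθ : θ ∈ homogeneousOperators K n (m + 1)) :
    commutatorWith l θ ∈ homogeneousOperators K n m := by
  induction hθ using Submodule.span_induction with
  | mem x hx =>
    obtain ⟨α, hα, rfl⟩ := hx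
    exact commutatorWith_mem_of_partialPow hl α hα
  | zero => simp [commutatorWith]
  | add x y _ _ hx hy =>
    have : commutatorWith l (x + y) = commutatorWith l x + commutatorWith l y := by
      simp only [commutatorWith, add_mul, mul_add]
      abel
    rw [this]
    exact add_mem hx hy
  | smul f x _ hx =>
    have : commutatorWith l (f • x) = f • commutatorWith l x := by
      refine LinearMap.ext fun g => ?_
      simp only [commutatorWith_apply, End_smul_apply]
      ring
    rw [this]
    exact Submodule.smul_mem _ f hx

theorem apply_mul_of_order_one {θ : Module.End K (MvPolynomial (Fin n) K)}
    (hθ : θ ∈ homogeneousOperators K n 1) (f g : MvPolynomial (Fin n) K) :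
    θ (f * g) = f * θ g + g * θ f := by
  induction hθ using Submodule.span_induction with
  | mem x hx =>
    obtain ⟨α, hα, rfl⟩ := hx
    obtain ⟨i, α', rfl, hα'⟩ := exists_eq_add_single hα
    obtain rfl : α' = 0 := (Finsupp.degree_eq_zero_iff α').1 hα'
    rw [zero_add, partialPow_single]
    exact Derivation.leibniz _ f g
  | zero => simp
  | add x y _ _ hx hy =>
    simp only [LinearMap.add_apply, hx, hy]
    ring
  | smul a x _ hx =>
    simp only [End_smul_apply, hx]
    ring

/-- Induction on the order. The commutator with `p j` has order one less, still preserves the ideal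
of `l * Q'`, and agrees with `θ(p j * ·)` on forms of degree too small for `θ` to see. In order one,
`θ` is a derivation and `l` is prime to `Q'`. -/
theorem dvd_apply_mul_prod [CharZero K] {ι : Type*} [DecidableEq ι]
    {l Q' : MvPolynomial (Fin n) K} (hl : l.IsHomogeneous 1) (hprime : Prime l) (hQ' : ¬ l ∣ Q')
    {p : ι → MvPolynomial (Fin n) K} : ∀ {m : ℕ} {J : Finset ι}
    {θ : Module.End K (MvPolynomial (Fin n) K)}
    (_ : θ ∈ homogeneousOperators K n (m + 1)) (_ : ∀ g, l * Q' ∣ g → l * Q' ∣ θ g)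
    (_ : ∀ j ∈ J, (p j).IsHomogeneous 1) (_ : J.card = m), l ∣ θ (l * ∏ j ∈ J, p j) := by
  intro m
  induction m with
  | zero =>
    intro J θ hθ hQ hp hJ
    obtain rfl := Finset.card_eq_zero.1 hJ
    rw [Finset.prod_empty, mul_one]
    have h1 := (dvd_mul_right l Q').trans (hQ _ dvd_rfl)
    rw [apply_mul_of_order_one hθ, dvd_add_right (dvd_mul_right l _)] at h1
    exact (hprime.dvd_or_dvd h1).resolve_left hQ'
  | succ m ih =>
    intro J θ hθ hQ hp hJ
    obtain ⟨j, hj⟩ : J.Nonempty := Finset.card_pos.1 (by omega)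
    have hJ' : (J.erase j).card = m := by rw [Finset.card_erase_of_mem hj]; omega
    have hdeg : (l * ∏ k ∈ J.erase j, p k).IsHomogeneous (1 + m) := by
      refine hl.mul ?_
      simpa [hJ'] using IsHomogeneous.prod (J.erase j) p (fun _ => 1)
        fun k hk => hp k (Finset.mem_of_mem_erase hk)
    have h1 := ih (commutatorWith_mem (hp j hj) hθ) (fun g hg =>
      dvd_sub (hQ _ (hg.mul_left _)) ((hQ g hg).mul_left _))
      (fun k hk => hp k (Finset.mem_of_mem_erase hk)) hJ'
    rw [commutatorWith_apply, apply_eq_zero_of_lt (by omega) hθ hdeg, mul_zero, sub_zero,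
      mul_left_comm, Finset.mul_prod_erase J p hj] at h1
    exact h1

/-- The commutator of `θ` with `l` has order `m`, and its coefficients are determined by its values
on monomials of degree `m`. The hypothesis makes all of them divisible by `l`. -/
theorem dvd_apply_mul [CharZero K] {m : ℕ} {l : MvPolynomial (Fin n) K} (hl : l.IsHomogeneous 1)
    {θ : Module.End K (MvPolynomial (Fin n) K)} (hθ : θ ∈ homogeneousOperators K n (m + 1))
    (h : ∀ g, IsHomogeneous g m → l ∣ θ (l * g)) (g : MvPolynomial (Fin n) K) :
    l ∣ θ (l * g) := by
  have h1 := operatorOf_eq_self (commutatorWith_mem hl hθ)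
  have h2 : l ∣ commutatorWith l θ g := by
    rw [← h1, operatorOf, LinearMap.sum_apply]
    refine Finset.dvd_sum fun α hα => ?_
    rw [End_smul_apply]
    refine Dvd.dvd.mul_right (dvd_smul_of_dvd _ ?_) _
    rw [commutatorWith_apply]
    exact dvd_sub (h _ (isHomogeneous_monomial _ (mem_finsuppAntidiag_univ.1 hα)))
      (dvd_mul_right _ _)
  rw [commutatorWith_apply] at h2
  simpa using dvd_add h2 (dvd_mul_right l (θ g))

end Operators

/-! ### The arrangement module: divisibility criterion, Euler and line operators, rank bound,
binomial inequality. -/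

section Arrangement

variable {K : Type*} [Field K] {ι : Type*} [DecidableEq ι]

/-- Restriction has the multiples of `l` as kernel and takes values in a domain. -/
theorem HyperplaneRestriction.prime {n : ℕ} {l : MvPolynomial (Fin (n + 1)) K}
    (ρ : HyperplaneRestriction l) (hl0 : l ≠ 0) : Prime l := by
  refine ⟨hl0, fun hu => ?_, fun a b hab => ?_⟩
  · have h1 := (ρ.res_eq_zero_iff 1).2 (isUnit_iff_dvd_one.1 hu)
    rw [map_one] at h1
    exact one_ne_zero h1
  · rw [← ρ.res_eq_zero_iff, map_mul, mul_eq_zero] at hab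
    exact hab.imp (ρ.res_eq_zero_iff a).1 (ρ.res_eq_zero_iff b).1

namespace IsGenericFamily

variable {n m : ℕ} {A B : Finset ι} {p : ι → MvPolynomial (Fin (n + 1 + 1)) K}
  {v : Finset ι → Fin (n + 1 + 1) → K}

theorem prime (h : IsGenericFamily A p v) (hA : n + 2 ≤ A.card) {i : ι} (hi : i ∈ A) :
    Prime (p i) := by
  have hpi := h.ne_zero hA hi
  obtain ⟨ρ⟩ := nonempty_hyperplaneRestriction (h.isHomogeneous i hi) hpi
  exact ρ.prime hpi

theorem not_dvd (h : IsGenericFamily A p v) (hA : n + 2 ≤ A.card) {i j : ι} (hi : i ∈ A)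
    (hj : j ∈ A) (hij : j ≠ i) : ¬ p i ∣ p j := by
  have hpi := h.ne_zero hA hi
  obtain ⟨ρ⟩ := nonempty_hyperplaneRestriction (h.isHomogeneous i hi) hpi
  rw [← ρ.res_eq_zero_iff]
  exact (h.restrict hi ρ).ne_zero (by rw [Finset.card_erase_of_mem hi]; omega)
    (Finset.mem_erase.2 ⟨hij, hj⟩)

theorem prod_dvd_of_forall_dvd (h : IsGenericFamily A p v) (hA : n + 2 ≤ A.card) {J : Finset ι}
    (hJ : J ⊆ A) {g : MvPolynomial (Fin (n + 1 + 1)) K} (hg : ∀ i ∈ J, p i ∣ g) :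
    ∏ i ∈ J, p i ∣ g := by
  refine Finset.prod_dvd_of_isRelPrime (fun i hi j hj hij => ?_) hg
  exact ((h.prime hA (hJ hi)).irreducible.isRelPrime_iff_not_dvd).2
    (h.not_dvd hA (hJ hi) (hJ hj) hij.symm)

/-- Distinct forms are non-associated primes, so both sides can be tested one form at a time.
`dvd_apply_mul_prod` gives one direction; `dvd_of_homogeneous` followed by `dvd_apply_mul` gives the
other. -/
theorem mem_idealizer_iff [CharZero K] (h : IsGenericFamily A p v) (hA : n + 2 ≤ A.card)
    (hm : n + 1 + m ≤ A.card) {θ : Module.End K (MvPolynomial (Fin (n + 1 + 1)) K)}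
    (hθ : θ ∈ homogeneousOperators K (n + 1 + 1) m) :
    θ ∈ idealizer (Ideal.span {∏ i ∈ A, p i}) ↔
      ∀ J ⊆ A, J.card = m → ∏ i ∈ J, p i ∣ θ (∏ i ∈ J, p i) := by
  have h1 : θ ∈ idealizer (Ideal.span {∏ i ∈ A, p i}) ↔
      ∀ g, ∏ i ∈ A, p i ∣ g → ∏ i ∈ A, p i ∣ θ g := by
    simp only [← Ideal.mem_span_singleton]
    exact ⟨fun h => h.2, fun h => ⟨homogeneousOperators_subset_weylAlgebra K _ m θ hθ, h⟩⟩
  rw [h1]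
  refine ⟨fun hQ J hJ hJm => ?_, fun hJ g hg => ?_⟩
  · refine h.prod_dvd_of_forall_dvd hA hJ fun i hi => ?_
    obtain ⟨m, rfl⟩ : ∃ k, m = k + 1 :=
      Nat.exists_eq_add_one.2 (hJm ▸ Finset.card_pos.2 ⟨i, hi⟩)
    have hQ' := Finset.mul_prod_erase A p (hJ hi)
    rw [← hQ'] at hQ
    rw [← Finset.mul_prod_erase J p hi]
    have hprime := h.prime hA (hJ hi)
    refine dvd_apply_mul_prod (h.isHomogeneous i (hJ hi)) hprime ?_ hθ hQ
      (fun j hj => h.isHomogeneous j (hJ (Finset.mem_of_mem_erase hj)))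
      (by rw [Finset.card_erase_of_mem hi]; omega)
    rw [hprime.dvd_finsetProd_iff]
    rintro ⟨j, hj, hd⟩
    exact h.not_dvd hA (hJ hi) (Finset.mem_of_mem_erase hj) (Finset.ne_of_mem_erase hj) hd
  · refine h.prod_dvd_of_forall_dvd hA subset_rfl fun i hi => ?_
    obtain ⟨q, rfl⟩ := (Finset.dvd_prod_of_mem p hi).trans hg
    obtain _ | m := m
    -- An operator of order zero is a multiplication.
    · have h2 := operatorOf_eq_self hθ
      rw [← h2, operatorOf, Finset.finsuppAntidiag_zero, Finset.sum_singleton, End_smul_apply,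
        partialPow_zero]
      exact Dvd.dvd.mul_left (dvd_mul_right _ _) _
    · exact dvd_apply_mul (h.isHomogeneous i hi) hθ
        (fun g hg => h.dvd_of_homogeneous hi hm θ hJ hg) q

/-- An operator homogeneous of order `m` sending every product of `m` of the forms to a multiple of
itself is a combination of the Euler operator and of the line operators meeting `B`. -/
theorem exists_eq_sum_operatorOf [CharZero K] (h : IsGenericFamily A p v)
    (hA : n + 1 + m ≤ A.card)
    (hB : B ⊆ A) (hBm : B.card = m) {θ : Module.End K (MvPolynomial (Fin (n + 1 + 1)) K)}
    (hθ : θ ∈ homogeneousOperators K (n + 1 + 1) m)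
    (hJ : ∀ J ⊆ A, J.card = m → ∏ i ∈ J, p i ∣ θ (∏ i ∈ J, p i)) :
    ∃ (f : MvPolynomial (Fin (n + 1 + 1)) K) (c : Finset ι → MvPolynomial (Fin (n + 1 + 1)) K),
      θ = f • operatorOf m 1 +
        ∑ Y ∈ meetingSubsets A B (n + 1), c Y • operatorOf m (lineOperator A p v Y) := by
  obtain ⟨ψ, hψ, hψθ⟩ := h.exists_mem_lineSpan hA θ hJ
  obtain ⟨f, c, hfc⟩ := h.exists_sum_meeting hB hBm hψ
  refine ⟨f, c, operator_ext hθ (add_mem (Submodule.smul_mem _ _ (operatorOf_mem _ _))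
    (sum_mem fun Y _ => Submodule.smul_mem _ _ (operatorOf_mem _ _))) fun g hg => ?_⟩
  rw [hψθ g hg, hfc g hg]
  simp only [LinearMap.add_apply, LinearMap.sum_apply, End_smul_apply, operatorOf_apply _ hg,
    Module.End.one_apply]

theorem constantCoeff_eq_zero_of_operator_relation [CharZero K] (h : IsGenericFamily A p v)
    (hA : n + 1 ≤ A.card) {s : Finset (Finset ι)} (hs : s ⊆ A.powersetCard (n + 1))
    {c : Finset ι → MvPolynomial (Fin (n + 1 + 1)) K}
    (hc : ∑ X ∈ s, c X • operatorOf m (lineOperator A p v X) = 0)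
    {Y : Finset ι} (hY : Y ∈ s) : constantCoeff (c Y) = 0 := by
  refine h.constantCoeff_eq_zero_of_relation (m := m) hs hA (fun g hg => ?_) hY
  have := DFunLike.congr_fun hc g
  simpa only [LinearMap.sum_apply, End_smul_apply, operatorOf_apply _ hg,
    LinearMap.zero_apply] using this

theorem operatorOf_lineOperator_ne_zero [CharZero K] (h : IsGenericFamily A p v)
    (hA : n + 1 ≤ A.card) {Y : Finset ι} (hY : Y ∈ A.powersetCard (n + 1)) :
    operatorOf m (lineOperator A p v Y) ≠ 0 := by
  intro h0
  have := h.constantCoeff_eq_zero_of_operator_relation (m := m) hA (s := {Y}) (c := fun _ => 1)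
    (Finset.singleton_subset_iff.2 hY) (by rw [Finset.sum_singleton, h0, smul_zero])
    (Finset.mem_singleton_self Y)
  rw [map_one] at this
  exact one_ne_zero this

theorem hasPolynomialDegree_operatorOf_lineOperator [CharZero K] (h : IsGenericFamily A p v)
    (hA : n + 1 ≤ A.card) {Y : Finset ι} (hY : Y ∈ A.powersetCard (n + 1)) :
    HasPolynomialDegree (A.card - (n + 1)) (operatorOf m (lineOperator A p v Y)) := by
  have hY' := Finset.mem_powersetCard.1 hY
  refine ⟨h.operatorOf_lineOperator_ne_zero hA hY, Finsupp.onFinset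
    (Finset.univ.finsuppAntidiag m) (fun α => if α ∈ Finset.univ.finsuppAntidiag m then
      (monomialWeight K α)⁻¹ • lineOperator A p v Y (monomial α 1) else 0)
    (fun α hα => by by_contra hne; exact hα (if_neg hne)), ?_, fun α => ?_⟩
  · rw [Finsupp.onFinset_sum _ (g := fun α g => g • partialPow α) fun α => zero_smul _ _,
      operatorOf]
    exact Finset.sum_congr rfl fun α hα => by rw [if_pos hα]
  · rw [Finsupp.onFinset_apply]
    split_ifs
    · rw [lineOperator_apply, smul_smul, smul_eq_C_mul]
      exact (h.isHomogeneous_coProd hY'.1 (by omega)).C_mul _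
    · exact isHomogeneous_zero _ _ _

theorem operatorOf_mem_idealizer [CharZero K] (h : IsGenericFamily A p v) (hA : n + 2 ≤ A.card)
    (hm : n + 1 + m ≤ A.card) {ψ : Module.End K (MvPolynomial (Fin (n + 1 + 1)) K)}
    (hψ : ψ ∈ lineSpan A p v) :
    operatorOf m ψ ∈ idealizer (Ideal.span {∏ i ∈ A, p i}) := by
  rw [h.mem_idealizer_iff hA hm (operatorOf_mem m ψ)]
  intro J hJ hJm
  rw [operatorOf_apply _ (hJm ▸ h.isHomogeneous_prod hJ)]
  exact h.prod_dvd_of_mem_lineSpan hψ hJ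

/-- For `n + 1 + m` hyperplanes the interpolation products span the forms of degree `m`, so
evaluation at them embeds `M` in a free module whose rank is their number. -/
theorem finrank_le [CharZero K] (h : IsGenericFamily A p v) (hA : n + 1 + m ≤ A.card)
    {M : Submodule (MvPolynomial (Fin (n + 1 + 1)) K)
      (Module.End K (MvPolynomial (Fin (n + 1 + 1)) K))}
    (hM : M ≤ homogeneousOperators K (n + 1 + 1) m) :
    Module.finrank (MvPolynomial (Fin (n + 1 + 1)) K) M ≤ (n + 1 + m).choose (n + 1) := by
  obtain ⟨C, hC, hCc⟩ := Finset.exists_subset_card_eq hA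
  set ev : M →ₗ[MvPolynomial (Fin (n + 1 + 1)) K]
      (C.powersetCard (n + 1) → MvPolynomial (Fin (n + 1 + 1)) K) :=
    { toFun := fun θ X => (θ : Module.End K _) (coProd C p X)
      map_add' := fun _ _ => rfl
      map_smul' := fun _ _ => rfl } with hev
  have hinj : Function.Injective ev := by
    intro θ η hθη
    refine Subtype.ext (operator_ext (hM θ.2) (hM η.2) fun g hg => ?_)
    rw [(h.mono hC).interpolation hCc hg, map_sum, map_sum]
    refine Finset.sum_congr rfl fun X hX => ?_
    have : (θ : Module.End K _) (coProd C p X) = (η : Module.End K _) (coProd C p X) :=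
      congrFun hθη ⟨X, hX⟩
    rw [map_smul, map_smul, this]
  have := LinearMap.finrank_le_finrank_of_injective hinj
  rwa [Module.finrank_fintype_fun_eq_card, Fintype.card_coe, Finset.card_powersetCard,
    hCc] at this

end IsGenericFamily

/-- Equality at `t = 0`; by Pascal's rule each further step gains at least one, since the lower
index `a + 2` is at least two and `m ≥ 1`. The summand `t` records this gain and makes the
inequality strict when `t ≥ 1`. -/
theorem choose_add_choose_le (a m : ℕ) (hm : 1 ≤ m) (t : ℕ) :
    (a + 2 + m).choose (a + 2) + (a + 2 + t).choose (a + 2) + t ≤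
      (a + 2 + m + t).choose (a + 2) + 1 := by
  induction t with
  | zero => simp
  | succ t ih =>
    have h1 : (a + 2 + t).choose (a + 1) + 1 ≤ (a + 2 + m + t).choose (a + 1) := by
      have h2 : (a + 2 + t + 1).choose (a + 1) ≤ (a + 2 + m + t).choose (a + 1) :=
        Nat.choose_le_choose _ (by omega)
      rw [Nat.choose_succ_succ'] at h2
      have h3 : 0 < (a + 2 + t).choose a := Nat.choose_pos (by omega)
      omega
    have h4 : (a + 2 + t + 1).choose (a + 2) = (a + 2 + t).choose (a + 1) +
        (a + 2 + t).choose (a + 2) := Nat.choose_succ_succ' _ _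
    have h5 : (a + 2 + m + t + 1).choose (a + 2) = (a + 2 + m + t).choose (a + 1) +
        (a + 2 + m + t).choose (a + 2) := Nat.choose_succ_succ' _ _
    rw [show a + 2 + (t + 1) = a + 2 + t + 1 from rfl,
      show a + 2 + m + (t + 1) = a + 2 + m + t + 1 from rfl]
    omega

theorem choose_lt_choose_sub_choose {n r m : ℕ} (hn : 2 ≤ n) (hm : 1 ≤ m) (hr : n + m < r) :
    (n + m).choose n < r.choose n - (r - m).choose n + 1 := by
  obtain ⟨a, rfl⟩ := Nat.exists_eq_add_of_le' hn
  obtain ⟨t, rfl⟩ := Nat.exists_eq_add_of_le hr.le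
  have h1 := choose_add_choose_le a m hm t
  rw [show a + 2 + m + t - m = a + 2 + t by omega]
  omega

end Arrangement

/-! ### From a generic arrangement to a generic family of forms. -/

section Hyperplanes

variable {K : Type*} [Field K] {n : ℕ}

theorem exists_ne_zero_forall_eval_eq_zero {ι : Type*} {X : Finset ι}
    {p : ι → MvPolynomial (Fin n) K} (hp : ∀ i ∈ X, (p i).IsHomogeneous 1) (hX : X.card < n) :
    ∃ w : Fin n → K, w ≠ 0 ∧ ∀ i ∈ X, eval w (p i) = 0 := by
  have h1 : ∀ i : X, ∃ a : Fin n → K, p i = ∑ j, C (a j) * MvPolynomial.X j := fun i =>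
    exists_eq_sum_C_mul_X (hp i i.2)
  choose a ha using h1
  have h2 := LinearMap.ker_ne_bot_of_finrank_lt (f := (Matrix.of a).mulVecLin) (by simpa using hX)
  obtain ⟨w, hw, hw0⟩ := Submodule.exists_mem_ne_zero_of_ne_bot h2
  refine ⟨w, hw0, fun i hi => ?_⟩
  have h3 := congrFun (LinearMap.mem_ker.1 hw) ⟨i, hi⟩
  rw [show p i = _ from ha ⟨i, hi⟩]
  simpa [Matrix.mulVec, dotProduct] using h3

theorem IsGeneric.exists_isGenericFamily {A : Finset (Submodule K (Fin (n + 1) → K))}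
    (hA : IsGeneric A) {p : Submodule K (Fin (n + 1) → K) → MvPolynomial (Fin (n + 1)) K}
    (hp : ∀ H ∈ A, IsDefiningForm (p H) H) :
    ∃ v : Finset (Submodule K (Fin (n + 1) → K)) → Fin (n + 1) → K, IsGenericFamily A p v := by
  have h1 : ∀ X : Finset (Submodule K (Fin (n + 1) → K)), ∃ w : Fin (n + 1) → K,
      X ⊆ A → X.card = n → w ≠ 0 ∧ ∀ H ∈ X, eval w (p H) = 0 := by
    intro X
    by_cases hX : X ⊆ A ∧ X.card = n
    · obtain ⟨w, hw⟩ := exists_ne_zero_forall_eval_eq_zero (X := X) (p := p)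
        (fun H hH => (hp H (hX.1 hH)).1) (by omega)
      exact ⟨w, fun _ _ => hw⟩
    -- Default value for sets that do not define a line.
    · exact ⟨0, fun h h' => absurd ⟨h, h'⟩ hX⟩
  choose v hv using h1
  refine ⟨v, fun H hH => (hp H hH).1, fun T hT hTc w hw => ?_, fun X hX hXc => (hv X hX hXc).1,
    fun X hX hXc => (hv X hX hXc).2⟩
  have h2 : w ∈ T.inf id := by
    rw [Submodule.mem_finsetInf]
    exact fun H hH => ((hp H (hT hH)).2 w).2 (hw H hH)
  rw [hA.generic T hT hTc] at h2
  exact (Submodule.mem_bot K).1 h2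

end Hyperplanes

/-! ### Generators of `Ξ`, their minimality, and failure of freeness. -/

section MainResult

variable {K : Type*} [Field K] [CharZero K] {k m : ℕ}
  {A B : Finset (Submodule K (Fin (k + 1 + 1) → K))}
  {p : Submodule K (Fin (k + 1 + 1) → K) → MvPolynomial (Fin (k + 1 + 1)) K}
  {v : Finset (Submodule K (Fin (k + 1 + 1) → K)) → Fin (k + 1 + 1) → K}

namespace IsGenericFamily

theorem operatorOf_mem_arrangementOperators [DecidableEq (Submodule K (Fin (k + 1 + 1) → K))]
    (h : IsGenericFamily A p v) (hA : k + 2 + m ≤ A.card)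
    {ψ : Module.End K (MvPolynomial (Fin (k + 1 + 1)) K)} (hψ : ψ ∈ lineSpan A p v) :
    operatorOf m ψ ∈ arrangementOperators A p m :=
  ⟨h.operatorOf_mem_idealizer (by omega) (by omega) hψ, operatorOf_mem m ψ⟩

theorem operatorOf_lineOperator_mem_annihilatingOperators
    [DecidableEq (Submodule K (Fin (k + 1 + 1) → K))]
    (h : IsGenericFamily A p v) (hA : k + 2 + m ≤ A.card) (hB : B ⊆ A) (hBm : B.card = m)
    {Y : Finset (Submodule K (Fin (k + 1 + 1) → K))} (hY : Y ∈ meetingSubsets A B (k + 1)) :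
    operatorOf m (lineOperator A p v Y) ∈ annihilatingOperators A p m B := by
  have hY' := mem_meetingSubsets.1 hY
  refine ⟨h.operatorOf_mem_arrangementOperators hA
    (lineOperator_mem_lineSpan p v hY'.1 hY'.2.1), ?_⟩
  rw [operatorOf_apply _ (hBm ▸ h.isHomogeneous_prod hB), h.lineOperator_prod_eq_zero hY]

theorem exists_eq_sum_of_mem_arrangementOperators
    [DecidableEq (Submodule K (Fin (k + 1 + 1) → K))]
    (h : IsGenericFamily A p v) (hA : k + 2 + m ≤ A.card) (hB : B ⊆ A) (hBm : B.card = m)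
    {θ : Module.End K (MvPolynomial (Fin (k + 1 + 1)) K)} (hθ : θ ∈ arrangementOperators A p m) :
    ∃ (f : MvPolynomial (Fin (k + 1 + 1)) K)
      (c : Finset (Submodule K (Fin (k + 1 + 1) → K)) → MvPolynomial (Fin (k + 1 + 1)) K),
      θ = f • operatorOf m 1 +
        ∑ Y ∈ meetingSubsets A B (k + 1), c Y • operatorOf m (lineOperator A p v Y) :=
  h.exists_eq_sum_operatorOf (by omega) hB hBm hθ.2
    ((h.mem_idealizer_iff (by omega) (by omega) hθ.2).1 hθ.1)

/-- The line operators meeting `B` kill `p_B` and `operatorOf m 1` fixes it, so the value at `p_B`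
is `f * p_B`. -/
theorem eq_zero_of_apply_prod_eq_zero [DecidableEq (Submodule K (Fin (k + 1 + 1) → K))]
    (h : IsGenericFamily A p v) (hA : k + 2 + m ≤ A.card) (hB : B ⊆ A) (hBm : B.card = m)
    {f : MvPolynomial (Fin (k + 1 + 1)) K}
    {c : Finset (Submodule K (Fin (k + 1 + 1) → K)) → MvPolynomial (Fin (k + 1 + 1)) K}
    (hf : (f • operatorOf m 1 + ∑ Y ∈ meetingSubsets A B (k + 1),
      c Y • operatorOf m (lineOperator A p v Y) :
        Module.End K (MvPolynomial (Fin (k + 1 + 1)) K)) (∏ H ∈ B, p H) = 0) : f = 0 := by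
  have hBh := hBm ▸ h.isHomogeneous_prod hB
  rw [LinearMap.add_apply, LinearMap.sum_apply, Finset.sum_eq_zero, add_zero, End_smul_apply,
    operatorOf_apply _ hBh, Module.End.one_apply] at hf
  · exact (mul_eq_zero.1 hf).resolve_right (h.prod_ne_zero (by omega) hB)
  · intro Y hY
    rw [End_smul_apply, operatorOf_apply _ hBh, h.lineOperator_prod_eq_zero hY, mul_zero]

theorem span_annihilatingOperators [DecidableEq (Submodule K (Fin (k + 1 + 1) → K))]
    (h : IsGenericFamily A p v) (hA : k + 2 + m ≤ A.card) (hB : B ⊆ A) (hBm : B.card = m) :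
    Submodule.span (MvPolynomial (Fin (k + 1 + 1)) K)
      (Set.range fun Y : meetingSubsets A B (k + 1) => operatorOf m (lineOperator A p v Y)) =
      annihilatingOperators A p m B := by
  refine le_antisymm (Submodule.span_le.2 ?_) fun θ hθ => ?_
  · rintro _ ⟨Y, rfl⟩
    exact h.operatorOf_lineOperator_mem_annihilatingOperators hA hB hBm Y.2
  · obtain ⟨f, c, rfl⟩ := h.exists_eq_sum_of_mem_arrangementOperators hA hB hBm hθ.1
    rw [h.eq_zero_of_apply_prod_eq_zero hA hB hBm hθ.2, zero_smul, zero_add]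
    exact sum_mem fun Y hY => Submodule.smul_mem _ _ (Submodule.subset_span ⟨⟨Y, hY⟩, rfl⟩)

theorem constantCoeff_eq_zero_of_sum_meeting [DecidableEq (Submodule K (Fin (k + 1 + 1) → K))]
    (h : IsGenericFamily A p v) (hA : k + 2 + m ≤ A.card)
    {f : meetingSubsets A B (k + 1) → MvPolynomial (Fin (k + 1 + 1)) K}
    (hf : ∑ Y : meetingSubsets A B (k + 1), f Y • operatorOf m (lineOperator A p v Y) = 0)
    (Y : meetingSubsets A B (k + 1)) : constantCoeff (f Y) = 0 := by
  have h1 := h.constantCoeff_eq_zero_of_operator_relation (m := m) (by omega)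
    (s := meetingSubsets A B (k + 1)) (Finset.filter_subset _ _)
    (c := fun Y => if hY : Y ∈ meetingSubsets A B (k + 1) then f ⟨Y, hY⟩ else 0) (by
      rw [← hf, ← Finset.sum_coe_sort]
      exact Finset.sum_congr rfl fun Y _ => by rw [dif_pos Y.2]) Y.2
  rwa [dif_pos Y.2] at h1

theorem constantCoeff_eq_zero_of_sum_option [DecidableEq (Submodule K (Fin (k + 1 + 1) → K))]
    (h : IsGenericFamily A p v) (hA : k + 2 + m ≤ A.card) (hB : B ⊆ A) (hBm : B.card = m)
    {f : MvPolynomial (Fin (k + 1 + 1)) K}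
    {c : meetingSubsets A B (k + 1) → MvPolynomial (Fin (k + 1 + 1)) K}
    (hf : f • operatorOf m 1 + ∑ Y : meetingSubsets A B (k + 1),
      c Y • operatorOf m (lineOperator A p v Y) = 0) :
    constantCoeff f = 0 ∧ ∀ Y, constantCoeff (c Y) = 0 := by
  have h1 : ∑ Y : meetingSubsets A B (k + 1), c Y • operatorOf m (lineOperator A p v Y) =
      ∑ Y ∈ meetingSubsets A B (k + 1), (if hY : Y ∈ meetingSubsets A B (k + 1) then
        c ⟨Y, hY⟩ else 0) • operatorOf m (lineOperator A p v Y) := by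
    conv_rhs => rw [← Finset.sum_coe_sort]
    exact Finset.sum_congr rfl fun Y _ => by rw [dif_pos Y.2]
  have h0 : f = 0 := by
    rw [h1] at hf
    exact h.eq_zero_of_apply_prod_eq_zero hA hB hBm (by rw [hf, LinearMap.zero_apply])
  rw [h0, zero_smul, zero_add] at hf
  exact ⟨by rw [h0, map_zero], h.constantCoeff_eq_zero_of_sum_meeting hA hf⟩

theorem exists_isMinimalGenerators [DecidableEq (Submodule K (Fin (k + 1 + 1) → K))]
    (h : IsGenericFamily A p v) (hA : k + 2 + m ≤ A.card) (hB : B ⊆ A) (hBm : B.card = m) :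
    ∃ θ : Fin (A.card.choose (k + 1) - (A.card - m).choose (k + 1)) →
        Module.End K (MvPolynomial (Fin (k + 1 + 1)) K),
      IsMinimalGenerators θ (annihilatingOperators A p m B) ∧
        ∀ i, HasPolynomialDegree (A.card - (k + 1)) (θ i) := by
  have hcard := card_meetingSubsets hB (k + 1)
  rw [hBm] at hcard
  set e := Finset.equivFinOfCardEq hcard with he
  refine ⟨fun j => operatorOf m (lineOperator A p v (e.symm j)),
    isMinimalGenerators_of_relations (constantCoeff (σ := Fin (k + 1 + 1)) (R := K)) ?_
      fun f hf j => ?_, fun j => ?_⟩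
  · rw [← h.span_annihilatingOperators hA hB hBm]
    congr 1
    exact e.symm.surjective.range_comp
      fun Y : meetingSubsets A B (k + 1) => operatorOf m (lineOperator A p v Y)
  · rw [← Equiv.sum_comp e] at hf
    simp only [Equiv.symm_apply_apply] at hf
    have := h.constantCoeff_eq_zero_of_sum_meeting hA hf (e.symm j)
    rwa [Equiv.apply_symm_apply] at this
  · exact h.hasPolynomialDegree_operatorOf_lineOperator (by omega)
      (Finset.filter_subset _ _ (e.symm j).2)

/-- A basis would have at least as many elements as the minimal system formed by the Euler operator
and the line operators meeting `B`, but no more than the rank bound allows. -/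
theorem not_free_arrangementOperators [DecidableEq (Submodule K (Fin (k + 1 + 1) → K))]
    (h : IsGenericFamily A p v) (hA : k + 2 + m ≤ A.card) (hB : B ⊆ A) (hBm : B.card = m)
    (hlt : (k + 1 + m).choose (k + 1) <
      A.card.choose (k + 1) - (A.card - m).choose (k + 1) + 1) :
    ¬ Module.Free (MvPolynomial (Fin (k + 1 + 1)) K) (arrangementOperators A p m) := by
  intro hfree
  -- `none` indexes the Euler operator.
  set θ : Option (meetingSubsets A B (k + 1)) → Module.End K (MvPolynomial (Fin (k + 1 + 1)) K) :=
    fun Y => Y.elim (operatorOf m 1) fun Y => operatorOf m (lineOperator A p v Y) with hθ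
  have hspan : Submodule.span (MvPolynomial (Fin (k + 1 + 1)) K) (Set.range θ) =
      arrangementOperators A p m := by
    refine le_antisymm (Submodule.span_le.2 ?_) fun η hη => ?_
    · rintro _ ⟨_ | Y, rfl⟩
      · exact h.operatorOf_mem_arrangementOperators hA (one_mem_lineSpan A p v)
      · exact (h.operatorOf_lineOperator_mem_annihilatingOperators hA hB hBm Y.2).1
    · obtain ⟨f, c, rfl⟩ := h.exists_eq_sum_of_mem_arrangementOperators hA hB hBm hη
      refine add_mem (Submodule.smul_mem _ _ (Submodule.subset_span ⟨none, rfl⟩)) ?_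
      exact sum_mem fun Y hY =>
        Submodule.smul_mem _ _ (Submodule.subset_span ⟨some ⟨Y, hY⟩, rfl⟩)
  have hfin : Module.Finite (MvPolynomial (Fin (k + 1 + 1)) K) (arrangementOperators A p m) :=
    Module.Finite.iff_fg.2 (hspan ▸ Submodule.fg_span (Set.finite_range θ))
  set b := Module.Free.chooseBasis (MvPolynomial (Fin (k + 1 + 1)) K)
    (arrangementOperators A p m) with hb
  have hbspan : Submodule.span (MvPolynomial (Fin (k + 1 + 1)) K)
      (Set.range fun i => (b i : Module.End K (MvPolynomial (Fin (k + 1 + 1)) K))) =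
      Submodule.span (MvPolynomial (Fin (k + 1 + 1)) K) (Set.range θ) := by
    rw [hspan, show (fun i => (b i : Module.End K (MvPolynomial (Fin (k + 1 + 1)) K))) =
      (arrangementOperators A p m).subtype ∘ b from rfl, Set.range_comp, Submodule.span_image,
      b.span_eq, Submodule.map_top, Submodule.range_subtype]
  have hle := card_le_card_of_relations (constantCoeff (σ := Fin (k + 1 + 1)) (R := K)) hbspan
    fun f hf Y => by
      rw [Fintype.sum_option] at hf
      obtain ⟨h1, h2⟩ := h.constantCoeff_eq_zero_of_sum_option hA hB hBm
        (f := f none) (c := fun Y => f (some Y)) hf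
      obtain _ | Y := Y
      · exact h1
      · exact h2 Y
  have hrank := h.finrank_le (m := m) (by omega) (M := arrangementOperators A p m) inf_le_right
  rw [Module.finrank_eq_card_chooseBasisIndex] at hrank
  have hcard := card_meetingSubsets hB (k + 1)
  rw [Fintype.card_option, Fintype.card_coe, hcard, hBm] at hle
  omega

end IsGenericFamily

end MainResult

end GenericArrangement

theorem mainTheorem4 {K : Type*} [Field K] [CharZero K] (n r m : ℕ)
    (hn : 2 ≤ n) (hr : n ≤ r) (hm : m < r - n + 1)
    (A : Finset (Submodule K (Fin n → K))) (hA : GenericArrangement.IsGeneric A)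
    (hAr : A.card = r)
    (p : Submodule K (Fin n → K) → MvPolynomial (Fin n) K)
    (hp : ∀ H ∈ A, GenericArrangement.IsDefiningForm (p H) H)
    (B : Finset (Submodule K (Fin n → K))) (hB : B ⊆ A) (hBm : B.card = m) :
    (∃ θ : Fin (r.choose (n - 1) - (r - m).choose (n - 1)) →
          Module.End K (MvPolynomial (Fin n) K),
        GenericArrangement.IsMinimalGenerators θ
          (GenericArrangement.annihilatingOperators A p m B) ∧
        ∀ i, GenericArrangement.HasPolynomialDegree (r - n + 1) (θ i)) ∧
      (3 ≤ n → 1 ≤ m →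
        (n + m - 1).choose (n - 1) < r.choose (n - 1) - (r - m).choose (n - 1) + 1 ∧
        ¬ Module.Free (MvPolynomial (Fin n) K)
          (GenericArrangement.arrangementOperators A p m)) := by
  classical
  -- With `n = k + 2`, lines are cut out by `k + 1` hyperplanes, and the bound on `m` says `n + m ≤
  -- r`, one hyperplane more than interpolation needs.
  obtain ⟨k, rfl⟩ := Nat.exists_eq_add_of_le' hn
  subst hAr
  obtain ⟨v, hv⟩ := hA.exists_isGenericFamily hp
  have hA' : k + 2 + m ≤ A.card := by omega
  rw [show k + 2 - 1 = k + 1 from rfl, show A.card - (k + 2) + 1 = A.card - (k + 1) by omega,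
    show k + 2 + m - 1 = k + 1 + m by omega]
  refine ⟨hv.exists_isMinimalGenerators hA' hB hBm, fun hn3 hm1 => ?_⟩
  have hlt := GenericArrangement.choose_lt_choose_sub_choose (n := k + 1) (m := m)
    (r := A.card) (by omega) hm1 (by omega)
  exact ⟨hlt, hv.not_free_arrangementOperators hA' hB hBm hlt⟩
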